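/- Let $P_0=1$, $P_1(t)=t$, $(n+1)P_{n+1}(t)=(2n+1)tP_n(t)-nP_{n-1}(t)$ be the Legendre polynomials and, for $L\ge 1$, let $t_{L,L}$ be the largest zero of $P_L$. Let $\sigma$ be the rotation invariant surface measure on the unit sphere $\mathbb S^2\subset\mathbb R^3$ (total mass $4\pi$), write $|A|=\sigma(A)$ and $\|f\|_2=\|f\|_{L^2(\sigma)}$, and for $\delta\in[-1,1]$ let $\mathcal C_\delta(y)=\{x\in\mathbb S^2:\langle x,y\rangle\ge\delta\}$ be the spherical cap with apex $y\in\mathbb S^2$. Let $\mathcal S_L$ be the space of all functions $f=\sum_{l=0}^L\sum_{m=-l}^l a_l^m Y_l^m$ on $\mathbb S^2$ with complex coefficients $a_l^m$, where in spherical coordinates $$Y_l^m(\theta,\varphi)=\sqrt{\tfrac{2l+1}{4\pi}\tfrac{(l-m)!}{(l+m)!}}\,P_l^m(\cos\theta)e^{im\varphi},\qquad P_l^m(t)=\frac{(-1)^{m+l}}{2^l\,l!}(1-t^2)^{m/2}\frac{d^{m+l}}{dt^{m+l}}(1-t^2)^l$$ (extended continuously to the poles). For measurable $\Omega\subset\mathbb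 S^2$ put $$\lambda^2_{\mathcal S_L}(\Omega)=\sup_{f\in\mathcal S_L\setminus\{0\}}\frac{\int_\Omega|f|^2\,d\sigma}{\int_{\mathbb S^2}|f|^2\,d\sigma},\qquad \rho(\Omega,L)=\sup_{y\in\mathbb S^2}\frac{|\Omega\cap\mathcal C_{t_{L,L}}(y)|}{|\mathcal C_{t_{L,L}}(y)|},\qquad B_L=(1-t_{L,L})\left(\int_{t_{L,L}}^1P_L(t)^2\,dt\right)^{-1}.$$ **Theorem.** Let $L\ge 1$ be an integer. 1. For every $\sigma$-finite (positive, Borel) measure $\mu$ on $\mathbb S^2$, every $\delta$ with $t_{L,L}\le\delta<1$, and every $f\in\mathcal S_L$, $$\int_{\mathbb S^2}|f|^2\,d\mu\le\left(2\pi\int_\delta^1P_L(t)^2\,dt\right)^{-1}\cdot\|f\|_2^2\cdot\sup_{y\in\mathbb S^2}\mu(\mathcal C_\delta(y)),$$ as an inequality in $[0,\infty]$ with the convention $0\cdot\infty=0$. 2. For every measurable $\Omega\subset\mathbb S^2$, $$\lambda^2_{\mathcal S_L}(\Omega)\le B_L\cdot\rho(\Omega,L).$$ -/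

import Mathlib

open MeasureTheory
open scoped ENNReal

noncomputable section

/-- The unit sphere `S²` in Euclidean three-space (with its Borel σ-algebra). -/
abbrev S2 : Type := Metric.sphere (0 : EuclideanSpace ℝ (Fin 3)) 1

/-- The rotation invariant surface measure on `S²`, of total mass `4π`. -/
def surfaceMeasure : Measure S2 :=
  (volume : Measure (EuclideanSpace ℝ (Fin 3))).toSphere

/-- The Legendre polynomials, by the three term recurrence
`(n + 1) P_{n+1}(t) = (2 n + 1) t P_n(t) - n P_{n-1}(t)`, `P_0 = 1`, `P_1 = t`. -/
def legendreP : ℕ → Polynomial ℝ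
  | 0 => 1
  | 1 => Polynomial.X
  | n + 2 => Polynomial.C (1 / ((n : ℝ) + 2)) *
      (Polynomial.C (2 * (n : ℝ) + 3) * Polynomial.X * legendreP (n + 1)
        - Polynomial.C ((n : ℝ) + 1) * legendreP n)

/-- The largest zero `t_{L,L}` of the Legendre polynomial `P_L`, for `L ≥ 1`. (The set of zeros
is then finite and nonempty, so that its supremum is its largest element.) -/
def largestZero (L : ℕ) : ℝ := sSup {t : ℝ | (legendreP L).eval t = 0}

/-- The associated Legendre function
`P_l^m(t) = (-1)^(m+l) / (2^l l!) (1 - t²)^(m/2) (d/dt)^(m+l) (1 - t²)^l`, for `-l ≤ m ≤ l`.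
At `t = ±1` and `m ≠ 0`, the value of the power `√(1 - t²) ^ m` in Lean is `0`, for negative `m`
too, so that the expression has there the value `0` of its continuous extension. -/
def assocLegendre (l : ℕ) (m : ℤ) (t : ℝ) : ℝ :=
  (-1) ^ (m + l).toNat / (2 ^ l * (l.factorial : ℝ)) * √(1 - t ^ 2) ^ m *
    (Polynomial.derivative^[(m + l).toNat] ((1 - Polynomial.X ^ 2) ^ l : Polynomial ℝ)).eval t

/-- The spherical harmonic `Y_l^m`, for `-l ≤ m ≤ l`. A point with spherical coordinates `(θ, φ)`
has third coordinate `cos θ`, and `φ` is the argument of the complex number formed by its first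
two coordinates (the value chosen for `φ` is irrelevant at the poles). -/
def sphericalHarmonic (l : ℕ) (m : ℤ) (x : S2) : ℂ :=
  ((√((2 * (l : ℝ) + 1) / (4 * Real.pi) *
      (((l - m).toNat.factorial : ℝ) / ((l + m).toNat.factorial : ℝ))) *
    assocLegendre l m (x.1 2) : ℝ) : ℂ) *
  Complex.exp (Complex.I * (m : ℂ) * (Complex.arg ⟨x.1 0, x.1 1⟩ : ℂ))

/-- The space `𝓢_L` of spherical harmonics expansions `∑_{l ≤ L} ∑_{|m| ≤ l} a_l^m Y_l^m` of
maximum degree `L`, with complex coefficients. -/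
def bandLimited (L : ℕ) : Submodule ℂ (S2 → ℂ) :=
  Submodule.span ℂ {f | ∃ l : ℕ, l ≤ L ∧ ∃ m : ℤ, |m| ≤ (l : ℤ) ∧ f = sphericalHarmonic l m}

/-- The spherical cap `C_δ(x) = {y ∈ S² : ⟨x, y⟩ ≥ δ}`. -/
def sphericalCap (δ : ℝ) (x : S2) : Set S2 :=
  {y | δ ≤ inner ℝ (x : EuclideanSpace ℝ (Fin 3)) (y : EuclideanSpace ℝ (Fin 3))}

/-- The maximum Nyquist density `ρ(Ω, L) = sup_y |Ω ∩ C_{t_{L,L}}(y)| / |C_{t_{L,L}}(y)|`. -/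
def nyquistDensity (Ω : Set S2) (L : ℕ) : ℝ≥0∞ :=
  ⨆ y : S2, surfaceMeasure (Ω ∩ sphericalCap (largestZero L) y) /
    surfaceMeasure (sphericalCap (largestZero L) y)

/-- The concentration constant `λ^p_S(Ω) = sup_{f ∈ S \ {0}} ∫_Ω |f|^p dσ / ∫_{S²} |f|^p dσ`. -/
def concentration (p : ℝ) (S : Submodule ℂ (S2 → ℂ)) (Ω : Set S2) : ℝ≥0∞ :=
  ⨆ f ∈ {f : S2 → ℂ | f ∈ S ∧ f ≠ 0},
    (∫⁻ x in Ω, ‖f x‖ₑ ^ p ∂surfaceMeasure) / ∫⁻ x, ‖f x‖ₑ ^ p ∂surfaceMeasure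

/-- `B_L = (1 - t_{L,L}) (∫_{t_{L,L}}^1 P_L(t)² dt)⁻¹`. -/
def sieveConstant (L : ℕ) : ℝ :=
  (1 - largestZero L) * (∫ t in (largestZero L)..1, (legendreP L).eval t ^ 2)⁻¹

end

/-! ### Legendre polynomials -/

/-! Let `k` be `P_L` cut off to `[δ, 1]` and let `a = 2π ∫_δ^1 P_L²`. By Funk–Hecke, convolution
with the zonal kernel `k(⟨x, y⟩)` multiplies spherical harmonics of degree `l` by `c_l = 2π ∫_δ^1
P_L P_l`. To the right of the largest zero of `P_L` one has `P_l ≥ P_L ≥ 0` for `l ≤ L`, so `c_l ≥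
c_L = a > 0`. Convolution is therefore invertible on band-limited functions: `f = k * g` with `‖g‖ ≤
a⁻¹ ‖f‖`, by orthogonality of the degrees (`exists_truncatedLegendre_preimage`). Since `k` lives on
a cap and `∫ k² = a`, Cauchy–Schwarz gives `|f(x)|² ≤ a ∫_{C_δ(x)} |g|²`. Integrating against `μ`
and exchanging the integrals yields `a ∫ |g(y)|² μ(C_δ(y)) dσ(y)`, at most `a · a⁻² ‖f‖² sup_y
μ(C_δ(y))`. The second claim is the case of `σ` restricted to `Ω`, with the cap area `2π(1 - δ)`.
Funk–Hecke is proved for powers of isotropic complex linear forms. Rotation moves `x` to the pole,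
averaging about the axis turns the power into Laplace's integral for `P_l`, and Archimedes' theorem
(`map_inner_surfaceMeasure`) evaluates the zonal integral that remains. The `Y_l^m` lie in the span
of such powers, being up to constants the coefficients in `u` of a family of them
(`sum_derivative_one_sub_sq_pow`). -/

theorem legendreP_eval_add_two (n : ℕ) (t : ℝ) :
    ((n : ℝ) + 2) * (legendreP (n + 2)).eval t =
      (2 * n + 3) * t * (legendreP (n + 1)).eval t - (n + 1) * (legendreP n).eval t := by
  have h : (n : ℝ) + 2 ≠ 0 := by positivity
  simp only [legendreP, Polynomial.eval_mul, Polynomial.eval_sub, Polynomial.eval_C,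
    Polynomial.eval_X]
  field_simp

@[simp]
theorem legendreP_eval_zero (t : ℝ) : (legendreP 0).eval t = 1 := by simp [legendreP]

@[simp]
theorem legendreP_eval_one' (t : ℝ) : (legendreP 1).eval t = t := by simp [legendreP]

/-- This excludes zeros beyond `1`. The recurrence reads `(n+2)(P_{n+2} - P_{n+1}) =
(2n+3)(t-1)P_{n+1} + (n+1)(P_{n+1} - P_n)`. -/
theorem legendreP_one_le_and_monotone {t : ℝ} (ht : 1 ≤ t) (n : ℕ) :
    1 ≤ (legendreP n).eval t ∧ (legendreP n).eval t ≤ (legendreP (n + 1)).eval t := by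
  induction n with
  | zero => simpa using ht
  | succ n ih =>
    obtain ⟨h1, h2⟩ := ih
    have h3 : 1 ≤ (legendreP (n + 1)).eval t := h1.trans h2
    refine ⟨h3, ?_⟩
    have hr := legendreP_eval_add_two n t
    have hn : (0 : ℝ) ≤ n := n.cast_nonneg
    have h4 : 0 ≤ (t - 1) * (legendreP (n + 1)).eval t :=
      mul_nonneg (by linarith) (by linarith)
    have h5 : 0 ≤ (n + 1 : ℝ) * ((legendreP (n + 1)).eval t - (legendreP n).eval t) :=
      mul_nonneg (by linarith) (by linarith)
    have h6 : 0 ≤ (2 * n + 3 : ℝ) * ((t - 1) * (legendreP (n + 1)).eval t) :=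
      mul_nonneg (by linarith) h4
    have h7 : 0 ≤ (n + 2 : ℝ) *
        ((legendreP (n + 2)).eval t - (legendreP (n + 1)).eval t) := by linarith
    have h8 := nonneg_of_mul_nonneg_right h7 (by linarith)
    linarith

@[simp]
theorem legendreP_eval_at_one (n : ℕ) : (legendreP n).eval 1 = 1 := by
  induction n using Nat.twoStepInduction with
  | zero => simp
  | one => simp
  | more n h1 h2 =>
    have hr := legendreP_eval_add_two n 1
    rw [h1, h2] at hr
    have hn : (0 : ℝ) < n + 2 := by positivity
    apply mul_left_cancel₀ hn.ne'
    linarith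

/-- At the last zero `z` of `P_{n+1}` the recurrence gives `(n+2)P_{n+2}(z) = -(n+1)P_n(z) < 0`,
while `P_{n+2}(1) = 1`; so the last zero moves strictly to the right. Positivity of the lower
degrees is part of the induction because it supplies `P_n(z) > 0`. -/
theorem legendreP_exists_zero (n : ℕ) :
    ∃ z : ℝ, 0 ≤ z ∧ z < 1 ∧ (legendreP (n + 1)).eval z = 0 ∧
      (∀ t ∈ Set.Ioc z 1, 0 < (legendreP (n + 1)).eval t) ∧
      ∀ k ≤ n, ∀ t ∈ Set.Icc z 1, 0 < (legendreP k).eval t := by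
  induction n with
  | zero =>
    refine ⟨0, le_rfl, one_pos, by simp, fun t ht => by simpa using ht.1, fun k hk t _ => ?_⟩
    obtain rfl : k = 0 := by omega
    simp
  | succ n ih =>
    obtain ⟨z, hz0, hz1, hz, hpos, hlow⟩ := ih
    have hr := legendreP_eval_add_two n z
    have hneg : (legendreP (n + 2)).eval z < 0 := by
      have h1 := hlow n le_rfl z ⟨le_rfl, hz1.le⟩
      have hn : (0 : ℝ) < n + 2 := by positivity
      have h2 : (0 : ℝ) < (n + 1) * (legendreP n).eval z := by positivity
      rw [hz] at hr
      by_contra! h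
      have := mul_nonneg hn.le h
      linarith
    have hc : Continuous fun t => (legendreP (n + 2)).eval t := (legendreP (n + 2)).continuous
    -- The greatest point of `[z, 1]` where `P_{n+2} ≤ 0`: maximality gives positivity to its right,
    -- and continuity then forces the value `0` there.
    let S : Set ℝ := Set.Icc z 1 ∩ {t | (legendreP (n + 2)).eval t ≤ 0}
    have hS : IsCompact S := isCompact_Icc.inter_right (isClosed_le hc continuous_const)
    obtain ⟨w, ⟨⟨hzw, hw1⟩, hw0⟩, hwmax⟩ :=
      hS.exists_isGreatest ⟨z, ⟨le_rfl, hz1.le⟩, hneg.le⟩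
    have hw0' : (legendreP (n + 2)).eval w ≤ 0 := hw0
    have hwlt : w < 1 := by
      refine lt_of_le_of_ne hw1 fun h => ?_
      rw [h, legendreP_eval_at_one] at hw0'
      linarith
    have hposw : ∀ t ∈ Set.Ioc w 1, 0 < (legendreP (n + 2)).eval t := fun t ht => by
      by_contra! h
      exact absurd (hwmax ⟨⟨hzw.trans ht.1.le, ht.2⟩, h⟩) (not_le.2 ht.1)
    have hw : (legendreP (n + 2)).eval w = 0 := by
      refine le_antisymm hw0' ?_
      have hcl : w ∈ closure (Set.Ioc w 1) := by
        rw [closure_Ioc hwlt.ne]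
        exact ⟨le_rfl, hwlt.le⟩
      exact closure_minimal (fun t ht => (hposw t ht).le) (isClosed_le continuous_const hc) hcl
    have hzw' : z < w := lt_of_le_of_ne hzw (by rintro rfl; linarith)
    refine ⟨w, hz0.trans hzw, hwlt, hw, hposw, fun k hk t ht => ?_⟩
    rcases Nat.lt_or_ge n k with h | h
    · obtain rfl : k = n + 1 := by omega
      exact hpos t ⟨hzw'.trans_le ht.1, ht.2⟩
    · exact hlow k h t ⟨hzw.trans ht.1, ht.2⟩

theorem legendreP_largestZero {L : ℕ} (hL : 1 ≤ L) :
    0 ≤ largestZero L ∧ largestZero L < 1 ∧ (legendreP L).eval (largestZero L) = 0 ∧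
      (∀ t ∈ Set.Ioc (largestZero L) 1, 0 < (legendreP L).eval t) ∧
      ∀ k < L, ∀ t ∈ Set.Icc (largestZero L) 1, 0 < (legendreP k).eval t := by
  obtain ⟨n, rfl⟩ : ∃ n, L = n + 1 := ⟨L - 1, by omega⟩
  obtain ⟨z, hz0, hz1, hz, hpos, hlow⟩ := legendreP_exists_zero n
  have hgr : IsGreatest {t : ℝ | (legendreP (n + 1)).eval t = 0} z := by
    refine ⟨hz, fun t (ht : _ = 0) => ?_⟩
    by_contra! h
    rcases le_total t 1 with h1 | h1
    · exact (hpos t ⟨h, h1⟩).ne' ht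
    · have := (legendreP_one_le_and_monotone h1 (n + 1)).1
      linarith
  have : largestZero (n + 1) = z := hgr.csSup_eq
  rw [this]
  exact ⟨hz0, hz1, hz, hpos, fun k hk => hlow k (by omega)⟩

theorem legendreP_largestZero_nonneg {L : ℕ} (hL : 1 ≤ L) {k : ℕ} (hk : k ≤ L) {t : ℝ}
    (ht : t ∈ Set.Icc (largestZero L) 1) : 0 ≤ (legendreP k).eval t := by
  obtain ⟨-, -, hz, hpos, hlow⟩ := legendreP_largestZero hL
  rcases hk.lt_or_eq with h | rfl
  · exact (hlow k h t ht).le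
  · rcases ht.1.lt_or_eq with h | h
    · exact (hpos t ⟨h, ht.2⟩).le
    · rw [← h, hz]

/-- The same rearranged recurrence with both differences reversed: `1 - t ≥ 0` and nonnegativity of
the values propagate the decrease in the degree. -/
theorem legendreP_succ_le_of_nonneg {t : ℝ} (ht : t ≤ 1) (n : ℕ)
    (h : ∀ k ≤ n, 0 ≤ (legendreP k).eval t) :
    (legendreP (n + 1)).eval t ≤ (legendreP n).eval t := by
  induction n with
  | zero => simpa using ht
  | succ n ih =>
    have h1 := ih fun k hk => h k (by omega)
    have h2 := h (n + 1) le_rfl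
    have hr := legendreP_eval_add_two n t
    have hn : (0 : ℝ) ≤ n := n.cast_nonneg
    have h4 : 0 ≤ (1 - t) * (legendreP (n + 1)).eval t := mul_nonneg (by linarith) h2
    have h5 : 0 ≤ (n + 1 : ℝ) * ((legendreP n).eval t - (legendreP (n + 1)).eval t) :=
      mul_nonneg (by linarith) (by linarith)
    have h6 : 0 ≤ (2 * n + 3 : ℝ) * ((1 - t) * (legendreP (n + 1)).eval t) :=
      mul_nonneg (by linarith) h4
    have h7 : 0 ≤ (n + 2 : ℝ) *
        ((legendreP (n + 1)).eval t - (legendreP (n + 2)).eval t) := by linarith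
    have h8 := nonneg_of_mul_nonneg_right h7 (by linarith)
    linarith

theorem legendreP_le_of_largestZero_le {L : ℕ} (hL : 1 ≤ L) {l : ℕ} (hl : l ≤ L) {t : ℝ}
    (ht : t ∈ Set.Icc (largestZero L) 1) : (legendreP L).eval t ≤ (legendreP l).eval t := by
  induction hl using Nat.decreasingInduction with
  | self => exact le_rfl
  | of_succ k hk ih =>
    exact ih.trans (legendreP_succ_le_of_nonneg ht.2 k fun j hj =>
      legendreP_largestZero_nonneg hL (by omega) ht)

theorem integral_legendreP_sq_pos (n : ℕ) {δ : ℝ} (hδ : δ < 1) :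
    0 < ∫ t in δ..1, (legendreP n).eval t ^ 2 :=
  intervalIntegral.integral_pos hδ ((legendreP n).continuous.pow 2).continuousOn
    (fun _ _ => sq_nonneg _) ⟨1, ⟨hδ.le, le_rfl⟩, by simp⟩

/-- Up to the factor `2π`, this is the eigenvalue bound `c_L ≤ c_l`; it is the reason for cutting at
or beyond the largest zero. -/
theorem integral_legendreP_sq_le {L : ℕ} (hL : 1 ≤ L) {l : ℕ} (hl : l ≤ L) {δ : ℝ}
    (hδ : largestZero L ≤ δ) (hδ1 : δ < 1) :
    ∫ t in δ..1, (legendreP L).eval t ^ 2 ≤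
      ∫ t in δ..1, (legendreP L).eval t * (legendreP l).eval t := by
  refine intervalIntegral.integral_mono_on hδ1.le
    (((legendreP L).continuous.pow 2).intervalIntegrable _ _)
    (((legendreP L).continuous.mul (legendreP l).continuous).intervalIntegrable _ _)
    fun t ht => ?_
  have ht' : t ∈ Set.Icc (largestZero L) 1 := ⟨hδ.trans ht.1, ht.2⟩
  rw [sq]
  exact mul_le_mul_of_nonneg_left (legendreP_le_of_largestZero_le hL hl ht')
    (legendreP_largestZero_nonneg hL le_rfl ht')

/-- At the largest zero of the polynomial of higher degree the other one is positive. Orthogonality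
of different degrees rests on this. -/
theorem integral_legendreP_sub_sq_pos {l m : ℕ} (hlm : l ≠ m) :
    0 < ∫ t in (-1 : ℝ)..1, ((legendreP l).eval t - (legendreP m).eval t) ^ 2 := by
  wlog h : l < m generalizing l m
  · simpa only [sub_sq_comm] using this hlm.symm (by omega)
  obtain ⟨h0, h1, hz, -, hlow⟩ := legendreP_largestZero (L := m) (by omega)
  refine intervalIntegral.integral_pos (by norm_num)
    (((legendreP l).continuous.sub (legendreP m).continuous).pow 2).continuousOn
    (fun _ _ => sq_nonneg _) ⟨largestZero m, ⟨by linarith, h1.le⟩, ?_⟩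
  have := hlow l h (largestZero m) ⟨le_rfl, h1.le⟩
  rw [hz, sub_zero]
  positivity

/-! ### The surface measure of the sphere -/

instance : IsFiniteMeasure surfaceMeasure := by
  unfold surfaceMeasure; infer_instance

theorem measurable_sphere_coord (i : Fin 3) : Measurable fun y : S2 => y.1 i := by
  have : Continuous fun y : S2 => y.1 i := by fun_prop
  exact this.measurable

theorem inner_sphere_mem_Icc (x y : S2) : inner ℝ x.1 y.1 ∈ Set.Icc (-1 : ℝ) 1 := by
  have := abs_real_inner_le_norm x.1 y.1
  rw [norm_eq_of_mem_sphere, norm_eq_of_mem_sphere, mul_one] at this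
  exact abs_le.1 this

/-- The action of a linear isometry of the space on the sphere. -/
noncomputable def sphereMap (R : EuclideanSpace ℝ (Fin 3) ≃ₗᵢ[ℝ] EuclideanSpace ℝ (Fin 3))
    (y : S2) : S2 :=
  ⟨R y.1, by simp⟩

theorem continuous_sphereMap (R : EuclideanSpace ℝ (Fin 3) ≃ₗᵢ[ℝ] EuclideanSpace ℝ (Fin 3)) :
    Continuous (sphereMap R) :=
  (R.continuous.comp continuous_subtype_val).subtype_mk _

open scoped Pointwise in
theorem measurePreserving_sphereMap
    (R : EuclideanSpace ℝ (Fin 3) ≃ₗᵢ[ℝ] EuclideanSpace ℝ (Fin 3)) :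
    MeasurePreserving (sphereMap R) surfaceMeasure surfaceMeasure := by
  have hm := (continuous_sphereMap R).measurable
  refine ⟨hm, Measure.ext fun s hs => ?_⟩
  rw [Measure.map_apply hm hs, surfaceMeasure, Measure.toSphere_apply' _ (hm hs),
    Measure.toSphere_apply' _ hs]
  congr 1
  rw [← R.measurePreserving.measure_preimage_emb R.toHomeomorph.measurableEmbedding
    (Set.Ioo (0 : ℝ) 1 • (Subtype.val '' s))]
  congr 1
  ext x
  simp only [Set.mem_smul, Set.mem_image, Set.mem_preimage]
  constructor
  · rintro ⟨r, hr, _, ⟨y, hy, rfl⟩, rfl⟩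
    exact ⟨r, hr, _, ⟨sphereMap R y, hy, rfl⟩, by simp [sphereMap]⟩
  · rintro ⟨r, hr, _, ⟨y, hy, rfl⟩, h⟩
    refine ⟨r, hr, _, ⟨sphereMap R.symm y, ?_, rfl⟩, ?_⟩
    · simpa [sphereMap] using hy
    · apply R.injective
      simpa [sphereMap] using h

theorem measurePreserving_coords :
    MeasurePreserving (fun x : EuclideanSpace ℝ (Fin 3) => (x 2, (x 0, x 1))) := by
  have h1 := EuclideanSpace.volume_preserving_symm_measurableEquiv_toLp (Fin 3)
  have h2 := volume_preserving_piFinSuccAbove (fun _ : Fin 3 => ℝ) 2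
  have h3 := (MeasurePreserving.id (volume : Measure ℝ)).prod (volume_preserving_finTwoArrow ℝ)
  exact h3.comp (h2.comp h1)

theorem lintegral_cylindrical {F : ℝ × ℝ → ℝ≥0∞} (hF : Measurable F) :
    ∫⁻ x : EuclideanSpace ℝ (Fin 3), F (√(x 0 ^ 2 + x 1 ^ 2), x 2) =
      ENNReal.ofReal (2 * Real.pi) * ∫⁻ p : ℝ × ℝ, ENNReal.ofReal p.1 * F p := by
  have hG : Measurable fun p : ℝ × ℝ × ℝ => F (√(p.2.1 ^ 2 + p.2.2 ^ 2), p.1) := by fun_prop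
  rw [measurePreserving_coords.lintegral_comp hG, Measure.volume_eq_prod,
    lintegral_prod _ hG.aemeasurable, Measure.volume_eq_prod ℝ ℝ,
    lintegral_prod_symm _ (by fun_prop), ← lintegral_const_mul' _ _ ENNReal.ofReal_ne_top]
  refine lintegral_congr fun z => ?_
  rw [← Measure.volume_eq_prod, ← lintegral_comp_polarCoord_symm, polarCoord_target,
    Measure.volume_eq_prod, ← Measure.prod_restrict]
  have : ∀ p ∈ Set.Ioi (0 : ℝ) ×ˢ Set.Ioo (-Real.pi) Real.pi,
      ENNReal.ofReal p.1 • F (√((polarCoord.symm p).1 ^ 2 + (polarCoord.symm p).2 ^ 2), z) =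
      (ENNReal.ofReal p.1 * F (p.1, z)) * 1 := by
    rintro ⟨r, θ⟩ ⟨hr, -⟩
    have : (r * Real.cos θ) ^ 2 + (r * Real.sin θ) ^ 2 = r ^ 2 := by
      linear_combination r ^ 2 * Real.cos_sq_add_sin_sq θ
    simp [this, Real.sqrt_sq (le_of_lt (Set.mem_Ioi.1 hr))]
  rw [Measure.prod_restrict, setLIntegral_congr_fun (measurableSet_Ioi.prod measurableSet_Ioo) this,
    ← Measure.prod_restrict, lintegral_prod_mul (f := fun r => ENNReal.ofReal r * F (r, z))
    (g := fun _ => 1) (by fun_prop) (by fun_prop), mul_comm]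
  congr 1
  · simp only [lintegral_const, MeasurableSet.univ, Measure.restrict_apply, Set.univ_inter,
      Real.volume_Ioo, one_mul]
    congr 1
    ring
  · rw [← lintegral_indicator measurableSet_Ioi]
    refine lintegral_congr fun r => ?_
    -- `ENNReal.ofReal r` vanishes for `r ≤ 0`, so the half-line may be replaced by the whole line.
    by_cases hr : 0 < r
    · simp [hr]
    · simp [hr, ENNReal.ofReal_of_nonpos (not_lt.1 hr)]

/-- Substitute `t = sin θ` on `[-π/2, π/2]`; elsewhere `cos θ ≤ 0` and `ENNReal.ofReal` discards it.
-/
theorem lintegral_cos_mul_comp_sin {g : ℝ → ℝ≥0∞} :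
    ∫⁻ θ in Set.Ioo (-Real.pi) Real.pi, ENNReal.ofReal (Real.cos θ) * g (Real.sin θ) =
      ∫⁻ t in Set.Icc (-1 : ℝ) 1, g t := by
  have hpi := Real.pi_pos
  have himg : Real.sin '' Set.Icc (-(Real.pi / 2)) (Real.pi / 2) = Set.Icc (-1) 1 :=
    Real.bijOn_sin.image_eq
  rw [← himg, lintegral_image_eq_lintegral_abs_deriv_mul measurableSet_Icc
    (fun x _ => (Real.hasDerivAt_sin x).hasDerivWithinAt) Real.injOn_sin,
    ← lintegral_indicator measurableSet_Ioo, ← lintegral_indicator measurableSet_Icc]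
  refine lintegral_congr fun θ => ?_
  by_cases h : θ ∈ Set.Icc (-(Real.pi / 2)) (Real.pi / 2)
  · have h' : θ ∈ Set.Ioo (-Real.pi) Real.pi := ⟨by linarith [h.1], by linarith [h.2]⟩
    rw [Set.indicator_of_mem h, Set.indicator_of_mem h',
      abs_of_nonneg (Real.cos_nonneg_of_mem_Icc h)]
  · rw [Set.indicator_of_notMem h]
    by_cases h' : θ ∈ Set.Ioo (-Real.pi) Real.pi
    · have : Real.cos θ ≤ 0 := by
        rcases le_total 0 θ with h0 | h0
        · refine Real.cos_nonpos_of_pi_div_two_le_of_le ?_ (by linarith [h'.2])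
          by_contra! h1
          exact h ⟨by linarith, h1.le⟩
        · rw [← Real.cos_neg]
          refine Real.cos_nonpos_of_pi_div_two_le_of_le ?_ (by linarith [h'.1])
          by_contra! h1
          exact h ⟨by linarith, by linarith⟩
      rw [Set.indicator_of_mem h', ENNReal.ofReal_of_nonpos this, zero_mul]
    · rw [Set.indicator_of_notMem h']

-- Archimedes' hat-box theorem. The measure of a set is three times the volume of the cone over it.
-- Cylindrical coordinates reduce this volume to an integral over (axial distance, height), and
-- polar coordinates in that plane split it into `∫_0^1 r² dr = 1/3`, which cancels the dimension,
-- and `∫ cos θ · 1_B(sin θ) dθ`.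
open scoped Pointwise in
theorem map_coord_two_surfaceMeasure :
    surfaceMeasure.map (fun y : S2 => y.1 2) =
      ENNReal.ofReal (2 * Real.pi) • volume.restrict (Set.Icc (-1 : ℝ) 1) := by
  ext B hB
  have hm := measurable_sphere_coord 2
  rw [Measure.map_apply hm hB, surfaceMeasure, Measure.toSphere_apply' _ (hm hB)]
  let ρ : ℝ × ℝ → ℝ := fun p => √(p.1 ^ 2 + p.2 ^ 2)
  have hρ : Measurable ρ := by fun_prop
  let D : Set (ℝ × ℝ) := {p | ρ p ∈ Set.Ioo (0 : ℝ) 1 ∧ p.2 / ρ p ∈ B}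
  have hD : MeasurableSet D :=
    (hρ measurableSet_Ioo).inter ((measurable_snd.div hρ) hB)
  have hnorm : ∀ x : EuclideanSpace ℝ (Fin 3), ρ (√(x 0 ^ 2 + x 1 ^ 2), x 2) = ‖x‖ := fun x => by
    simp only [ρ, EuclideanSpace.norm_eq, Fin.sum_univ_three, Real.norm_eq_abs, sq_abs]
    rw [Real.sq_sqrt (by positivity)]
  have hset : Set.Ioo (0 : ℝ) 1 • (Subtype.val '' ((fun y : S2 => y.1 2) ⁻¹' B)) =
      (fun x : EuclideanSpace ℝ (Fin 3) => (√(x 0 ^ 2 + x 1 ^ 2), x 2)) ⁻¹' D := by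
    ext x
    simp only [Set.mem_preimage, D, Set.mem_ofPred_eq, hnorm, Set.mem_smul]
    constructor
    · rintro ⟨r, hr, _, ⟨y, hy, rfl⟩, rfl⟩
      have h1 : ‖r • y.1‖ = r := by simp [norm_smul, abs_of_pos hr.1]
      rw [h1]
      refine ⟨hr, ?_⟩
      have : (r • y.1) 2 / r = y.1 2 := by simp [hr.1.ne']
      rw [this]
      exact hy
    · rintro ⟨hr, hx⟩
      have h0 : ‖x‖ ≠ 0 := hr.1.ne'
      refine ⟨‖x‖, hr, ‖x‖⁻¹ • x, ⟨⟨‖x‖⁻¹ • x, by simp [norm_smul, h0]⟩, ?_, rfl⟩, ?_⟩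
      · simpa [div_eq_inv_mul] using hx
      · rw [smul_smul, mul_inv_cancel₀ h0, one_smul]
  have hmx : Measurable fun x : EuclideanSpace ℝ (Fin 3) => (√(x 0 ^ 2 + x 1 ^ 2), x 2) := by
    fun_prop
  rw [hset, ← lintegral_indicator_one (hmx hD)]
  have hcyl := lintegral_cylindrical (F := D.indicator 1) (measurable_one.indicator hD)
  have hpol : ∫⁻ p : ℝ × ℝ, ENNReal.ofReal p.1 * D.indicator 1 p =
      3⁻¹ * volume (B ∩ Set.Icc (-1) 1) := by
    rw [← lintegral_comp_polarCoord_symm, polarCoord_target]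
    have : ∀ p ∈ Set.Ioi (0 : ℝ) ×ˢ Set.Ioo (-Real.pi) Real.pi,
        ENNReal.ofReal p.1 • (ENNReal.ofReal (polarCoord.symm p).1 *
          D.indicator 1 (polarCoord.symm p)) =
        (Set.Iio 1).indicator (fun r => ENNReal.ofReal (r ^ 2)) p.1 *
          (ENNReal.ofReal (Real.cos p.2) * B.indicator 1 (Real.sin p.2)) := by
      rintro ⟨r, θ⟩ ⟨hr, -⟩
      replace hr : 0 < r := hr
      have h1 : ρ (r * Real.cos θ, r * Real.sin θ) = r := by
        have : (r * Real.cos θ) ^ 2 + (r * Real.sin θ) ^ 2 = r ^ 2 := by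
          linear_combination r ^ 2 * Real.cos_sq_add_sin_sq θ
        simp only [ρ, this, Real.sqrt_sq hr.le]
      have h2 : (r * Real.cos θ, r * Real.sin θ) ∈ D ↔ r < 1 ∧ Real.sin θ ∈ B := by
        simp only [D, Set.mem_ofPred_eq, h1, Set.mem_Ioo, hr, true_and]
        rw [mul_div_cancel_left₀ _ hr.ne']
      simp only [polarCoord_symm_apply, smul_eq_mul]
      by_cases hr1 : r < 1 <;> by_cases hs : Real.sin θ ∈ B
      · rw [Set.indicator_of_mem (h2.2 ⟨hr1, hs⟩), Set.indicator_of_mem (Set.mem_Iio.2 hr1),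
          Set.indicator_of_mem hs, ENNReal.ofReal_mul hr.le, sq, ENNReal.ofReal_mul hr.le]
        simp only [Pi.one_apply]
        ring
      all_goals
        rw [Set.indicator_of_notMem (fun h => by have := h2.1 h; tauto)]
        simp [hr1, hs]
    rw [setLIntegral_congr_fun (measurableSet_Ioi.prod measurableSet_Ioo) this,
      Measure.volume_eq_prod, ← Measure.prod_restrict, lintegral_prod_mul
      (f := (Set.Iio 1).indicator fun r => ENNReal.ofReal (r ^ 2))
      (g := fun θ => ENNReal.ofReal (Real.cos θ) * B.indicator 1 (Real.sin θ)),
      lintegral_cos_mul_comp_sin (g := B.indicator 1),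
      lintegral_indicator_one hB, Measure.restrict_apply hB]
    · congr 1
      rw [setLIntegral_indicator measurableSet_Iio, Set.inter_comm, Set.Ioi_inter_Iio,
        Measure.restrict_congr_set Ioo_ae_eq_Ioc,
        ← ofReal_integral_eq_lintegral_ofReal, ← intervalIntegral.integral_of_le zero_le_one]
      · norm_num [integral_pow]
        rw [one_div, ENNReal.ofReal_inv_of_pos (by norm_num), ENNReal.ofReal_ofNat]
      · exact (continuous_pow 2).continuousOn.integrableOn_Icc.mono_set Set.Ioc_subset_Icc_self
      · exact ae_of_all _ fun x => sq_nonneg x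
    · exact ((ENNReal.measurable_ofReal.comp (measurable_id.pow_const 2)).indicator
        measurableSet_Iio).aemeasurable
    · exact ((ENNReal.measurable_ofReal.comp Real.measurable_cos).mul
        ((measurable_one.indicator hB).comp Real.measurable_sin)).aemeasurable
  have h3 : ((Module.finrank ℝ (EuclideanSpace ℝ (Fin 3)) : ℕ) : ℝ≥0∞) = 3 := by simp
  rw [hpol] at hcyl
  rw [h3, Measure.smul_apply, Measure.restrict_apply hB, smul_eq_mul]
  calc _ = 3 * (ENNReal.ofReal (2 * Real.pi) * (3⁻¹ * volume (B ∩ Set.Icc (-1) 1))) := by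
        rw [← hcyl]; rfl
    _ = (3 * 3⁻¹) * (ENNReal.ofReal (2 * Real.pi) * volume (B ∩ Set.Icc (-1) 1)) := by ring
    _ = _ := by rw [ENNReal.mul_inv_cancel (by norm_num) (by norm_num), one_mul]

theorem map_inner_surfaceMeasure (x : S2) :
    surfaceMeasure.map (fun y : S2 => inner ℝ x.1 y.1) =
      ENNReal.ofReal (2 * Real.pi) • volume.restrict (Set.Icc (-1 : ℝ) 1) := by
  obtain ⟨R, hR⟩ : ∃ R : EuclideanSpace ℝ (Fin 3) ≃ₗᵢ[ℝ] EuclideanSpace ℝ (Fin 3),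
      R (EuclideanSpace.single 2 1) = x.1 := ⟨_, Submodule.reflection_sub (by simp)⟩
  have hc : Continuous fun y : S2 => inner ℝ x.1 y.1 := by fun_prop
  rw [← (measurePreserving_sphereMap R).map_eq,
    Measure.map_map hc.measurable (continuous_sphereMap R).measurable,
    ← map_coord_two_surfaceMeasure]
  congr 1
  ext y
  simp only [Function.comp_apply, sphereMap, ← hR, LinearIsometryEquiv.inner_map_map,
    EuclideanSpace.inner_single_left]
  simp

theorem integral_zonal (x : S2) {h : ℝ → ℝ} (hh : Measurable h) :
    ∫ y : S2, h (inner ℝ x.1 y.1) ∂surfaceMeasure = 2 * Real.pi * ∫ t in (-1 : ℝ)..1, h t := by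
  have hc : Continuous fun y : S2 => inner ℝ x.1 y.1 := by fun_prop
  rw [← integral_map hc.measurable.aemeasurable hh.aestronglyMeasurable,
    map_inner_surfaceMeasure, integral_smul_measure, smul_eq_mul,
    ENNReal.toReal_ofReal (by positivity), integral_Icc_eq_integral_Ioc,
    intervalIntegral.integral_of_le (by norm_num)]

/-! ### Laplace's integral for the Legendre polynomials -/

/-- Let `E` be the base of the powers. Then `E'' = A - E` and `E'² = 4BC - (E - A)²`, so the
derivative of the periodic function `E^(n+1) E'` is a combination of `E^(n+2)`, `E^(n+1)` and `E^n`
whose integral vanishes. -/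
theorem integral_circle_pow_add_two (A B C : ℂ) (n : ℕ) :
    ((n : ℂ) + 2) * ∫ φ : ℝ in 0..2 * Real.pi,
        (A + B * Complex.exp (φ * Complex.I) + C * Complex.exp (-(φ * Complex.I))) ^ (n + 2) =
      (2 * n + 3) * A * (∫ φ : ℝ in 0..2 * Real.pi,
        (A + B * Complex.exp (φ * Complex.I) + C * Complex.exp (-(φ * Complex.I))) ^ (n + 1)) -
      (n + 1) * (A ^ 2 - 4 * B * C) * ∫ φ : ℝ in 0..2 * Real.pi,
        (A + B * Complex.exp (φ * Complex.I) + C * Complex.exp (-(φ * Complex.I))) ^ n := by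
  let E : ℝ → ℂ := fun φ =>
    A + B * Complex.exp (φ * Complex.I) + C * Complex.exp (-(φ * Complex.I))
  let E' : ℝ → ℂ := fun φ =>
    B * (Complex.exp (φ * Complex.I) * Complex.I) +
      C * (Complex.exp (-(φ * Complex.I)) * -Complex.I)
  have hexp (φ : ℝ) : HasDerivAt (fun φ : ℝ => Complex.exp (φ * Complex.I))
      (Complex.exp (φ * Complex.I) * Complex.I) φ := by
    have h : HasDerivAt (fun φ : ℝ => (φ : ℂ) * Complex.I) Complex.I φ := by
      simpa using (Complex.ofRealCLM.hasDerivAt (x := φ)).mul_const Complex.I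
    exact h.cexp
  have hexp' (φ : ℝ) : HasDerivAt (fun φ : ℝ => Complex.exp (-(φ * Complex.I)))
      (Complex.exp (-(φ * Complex.I)) * -Complex.I) φ := by
    have h : HasDerivAt (fun φ : ℝ => (φ : ℂ) * Complex.I) Complex.I φ := by
      simpa using (Complex.ofRealCLM.hasDerivAt (x := φ)).mul_const Complex.I
    exact h.neg.cexp
  have hE (φ : ℝ) : HasDerivAt E (E' φ) φ :=
    (((hexp φ).const_mul B).const_add A).add ((hexp' φ).const_mul C)
  have hE' (φ : ℝ) : HasDerivAt E' (A - E φ) φ := by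
    have h := (((hexp φ).mul_const Complex.I).const_mul B).add
      (((hexp' φ).mul_const (-Complex.I)).const_mul C)
    refine h.congr_deriv ?_
    simp only [E]
    linear_combination (B * Complex.exp (φ * Complex.I) + C * Complex.exp (-(φ * Complex.I))) *
      Complex.I_mul_I
  have hsq (φ : ℝ) : E' φ ^ 2 = 4 * B * C - (E φ - A) ^ 2 := by
    have h1 : Complex.exp (φ * Complex.I) * Complex.exp (-(φ * Complex.I)) = 1 := by
      rw [← Complex.exp_add, add_neg_cancel, Complex.exp_zero]
    simp only [E, E']
    linear_combination (B * Complex.exp (φ * Complex.I) - C * Complex.exp (-(φ * Complex.I))) ^ 2 *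
      Complex.I_mul_I - (-4 * B * C) * h1
  have hcE : Continuous E := by fun_prop
  have hcE' : Continuous E' := by fun_prop
  have hper : E (2 * Real.pi) = E 0 ∧ E' (2 * Real.pi) = E' 0 := by
    have h1 : Complex.exp (((2 * Real.pi : ℝ) : ℂ) * Complex.I) = 1 := by
      rw [← Complex.exp_two_pi_mul_I]
      push_cast
      rfl
    have h2 : Complex.exp (-(((2 * Real.pi : ℝ) : ℂ) * Complex.I)) = 1 := by
      rw [Complex.exp_neg, h1, inv_one]
    simp only [E, E', h1, h2]
    simp
  have hF (φ : ℝ) : HasDerivAt (fun φ => E φ ^ (n + 1) * E' φ)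
      (-((n : ℂ) + 2) * E φ ^ (n + 2) + (2 * n + 3) * A * E φ ^ (n + 1) -
        (n + 1) * (A ^ 2 - 4 * B * C) * E φ ^ n) φ := by
    refine (((hE φ).pow (n + 1)).mul (hE' φ)).congr_deriv ?_
    simp only [Nat.add_sub_cancel, Pi.pow_apply]
    push_cast
    linear_combination ((n : ℂ) + 1) * E φ ^ n * hsq φ
  have hint := intervalIntegral.integral_eq_sub_of_hasDerivAt (a := 0) (b := 2 * Real.pi)
    (fun φ _ => hF φ) (Continuous.intervalIntegrable (by fun_prop) _ _)
  rw [hper.1, hper.2, sub_self, intervalIntegral.integral_sub, intervalIntegral.integral_add,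
    intervalIntegral.integral_const_mul, intervalIntegral.integral_const_mul,
    intervalIntegral.integral_const_mul] at hint
  · linear_combination -hint
  all_goals exact Continuous.intervalIntegrable (by fun_prop) _ _

/-- Here `A² - 4BC = a²`, so the recurrence for the integrals is Legendre's, scaled by powers of
`a`. Keeping it homogeneous covers `a = 0`. -/
theorem integral_circle_pow_eq_legendreP {A B C a : ℂ} {t : ℝ} (hA : A = a * t)
    (hBC : 4 * B * C = a ^ 2 * ((t : ℂ) ^ 2 - 1)) (n : ℕ) :
    ∫ φ : ℝ in 0..2 * Real.pi,
        (A + B * Complex.exp (φ * Complex.I) + C * Complex.exp (-(φ * Complex.I))) ^ n =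
      2 * Real.pi * a ^ n * ((legendreP n).eval t : ℝ) := by
  induction n using Nat.twoStepInduction with
  | zero => simp
  | one =>
    have h1 : ∫ φ : ℝ in 0..2 * Real.pi, Complex.exp (φ * Complex.I) = 0 := by
      have := integral_exp_mul_complex (a := 0) (b := 2 * Real.pi) Complex.I_ne_zero
      simp only [mul_comm Complex.I] at this
      rw [this]
      simp [Complex.exp_two_pi_mul_I]
    have h2 : ∫ φ : ℝ in 0..2 * Real.pi, Complex.exp (-(φ * Complex.I)) = 0 := by
      have := integral_exp_mul_complex (a := 0) (b := 2 * Real.pi) (neg_ne_zero.2 Complex.I_ne_zero)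
      simp only [neg_mul, mul_comm Complex.I] at this
      rw [this]
      simp [Complex.exp_neg, Complex.exp_two_pi_mul_I]
    simp only [pow_one]
    rw [intervalIntegral.integral_add, intervalIntegral.integral_add,
      intervalIntegral.integral_const_mul, intervalIntegral.integral_const_mul, h1, h2, hA]
    · simp
      ring
    all_goals exact Continuous.intervalIntegrable (by fun_prop) _ _
  | more n h1 h2 =>
    have hr := integral_circle_pow_add_two A B C n
    rw [h1, h2, hBC, hA] at hr
    have hP := congrArg (fun s : ℝ => (s : ℂ)) (legendreP_eval_add_two n t)
    push_cast at hP
    have hn : (n : ℂ) + 2 ≠ 0 := by exact_mod_cast (by omega : n + 2 ≠ 0)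
    apply mul_left_cancel₀ hn
    rw [hA, hr]
    linear_combination -(2 * Real.pi * a ^ (n + 2)) * hP

/-! ### The Funk–Hecke formula -/

/-- The rotation by the angle `φ` about the third coordinate axis. -/
noncomputable def axisRotation (φ : ℝ) :
    EuclideanSpace ℝ (Fin 3) ≃ₗᵢ[ℝ] EuclideanSpace ℝ (Fin 3) :=
  LinearIsometry.toLinearIsometryEquiv
    { toFun := fun x => !₂[Real.cos φ * x 0 - Real.sin φ * x 1,
        Real.sin φ * x 0 + Real.cos φ * x 1, x 2]
      map_add' := fun x y => by ext i; fin_cases i <;> simp <;> ring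
      map_smul' := fun c x => by ext i; fin_cases i <;> simp <;> ring
      norm_map' := fun x => by
        simp only [LinearMap.coe_mk, AddHom.coe_mk, EuclideanSpace.norm_eq, Fin.sum_univ_three,
          Real.norm_eq_abs, sq_abs]
        congr 1
        simp
        linear_combination (x 0 ^ 2 + x 1 ^ 2) * Real.cos_sq_add_sin_sq φ } rfl

theorem axisRotation_apply (φ : ℝ) (x : EuclideanSpace ℝ (Fin 3)) :
    axisRotation φ x = !₂[Real.cos φ * x 0 - Real.sin φ * x 1,
        Real.sin φ * x 0 + Real.cos φ * x 1, x 2] := rfl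

/-- The complex linear form `⟪u, ·⟫ + i ⟪v, ·⟫`. -/
noncomputable def complexForm (u v x : EuclideanSpace ℝ (Fin 3)) : ℂ :=
  (inner ℝ u x : ℝ) + (inner ℝ v x : ℝ) * Complex.I

theorem complexForm_eq_sum (u v x : EuclideanSpace ℝ (Fin 3)) :
    complexForm u v x = (u 0 + v 0 * Complex.I) * x 0 + (u 1 + v 1 * Complex.I) * x 1 +
      (u 2 + v 2 * Complex.I) * x 2 := by
  simp only [complexForm, PiLp.inner_apply, Fin.sum_univ_three, RCLike.inner_apply, conj_trivial]
  push_cast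
  ring

theorem norm_complexForm_le (u v : EuclideanSpace ℝ (Fin 3)) (y : S2) :
    ‖complexForm u v y.1‖ ≤ ‖u‖ + ‖v‖ := by
  have h1 := abs_real_inner_le_norm u y.1
  have h2 := abs_real_inner_le_norm v y.1
  rw [norm_eq_of_mem_sphere, mul_one] at h1 h2
  refine (norm_add_le _ _).trans (add_le_add ?_ ?_)
  · simpa using h1
  · simpa using h2

theorem continuous_complexForm (u v : EuclideanSpace ℝ (Fin 3)) :
    Continuous fun y : S2 => complexForm u v y.1 := by
  unfold complexForm
  fun_prop

/-- The vector `w = u + iv` satisfies `w · w = 0` for the bilinear product; real and imaginary parts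
are the two hypotheses. -/
theorem isotropic_coords {u v : EuclideanSpace ℝ (Fin 3)} (huv : ‖u‖ = ‖v‖)
    (h0 : inner ℝ u v = 0) :
    ((u 0 : ℂ) + v 0 * Complex.I) ^ 2 + ((u 1 : ℂ) + v 1 * Complex.I) ^ 2 +
      ((u 2 : ℂ) + v 2 * Complex.I) ^ 2 = 0 := by
  have h1 : ‖u‖ ^ 2 = ‖v‖ ^ 2 := by rw [huv]
  rw [EuclideanSpace.norm_sq_eq, EuclideanSpace.norm_sq_eq] at h1
  simp only [Fin.sum_univ_three, Real.norm_eq_abs, sq_abs] at h1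
  simp only [PiLp.inner_apply, Fin.sum_univ_three, RCLike.inner_apply, conj_trivial] at h0
  have h1' := congrArg (fun s : ℝ => (s : ℂ)) h1
  have h0' := congrArg (fun s : ℝ => (s : ℂ)) h0
  push_cast at h1' h0'
  linear_combination h1' + 2 * Complex.I * h0' + ((v 0 : ℂ) ^ 2 + v 1 ^ 2 + v 2 ^ 2) * Complex.I_sq

theorem complexForm_axisRotation (u v x : EuclideanSpace ℝ (Fin 3)) (φ : ℝ) :
    complexForm u v (axisRotation φ x) =
      (u 2 + v 2 * Complex.I) * x 2 +
      ((u 0 + v 0 * Complex.I) - Complex.I * (u 1 + v 1 * Complex.I)) / 2 *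
        (x 0 + x 1 * Complex.I) * Complex.exp (φ * Complex.I) +
      ((u 0 + v 0 * Complex.I) + Complex.I * (u 1 + v 1 * Complex.I)) / 2 *
        (x 0 - x 1 * Complex.I) * Complex.exp (-(φ * Complex.I)) := by
  rw [complexForm_eq_sum, axisRotation_apply, ← neg_mul, Complex.exp_mul_I, Complex.exp_mul_I,
    Complex.cos_neg, Complex.sin_neg]
  simp
  generalize (u 0 : ℂ) + v 0 * Complex.I = a
  generalize (u 1 : ℂ) + v 1 * Complex.I = b
  linear_combination (-a * x 1 * Complex.sin φ + b * x 0 * Complex.sin φ +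
    b * x 1 * Complex.cos φ) * Complex.I_sq

/-- With `w = (a, b, c)` isotropic and `t = y₂`, the coefficients of `exp(±iφ)` satisfy `4BC = (a² +
b²)(y₀² + y₁²) = c²(t² - 1)`, which is what Laplace's integral requires. -/
theorem integral_circle_complexForm {u v : EuclideanSpace ℝ (Fin 3)} (huv : ‖u‖ = ‖v‖)
    (h0 : inner ℝ u v = 0) (l : ℕ) (y : S2) :
    ∫ φ : ℝ in 0..2 * Real.pi, complexForm u v (axisRotation φ y.1) ^ l =
      2 * Real.pi * (u 2 + v 2 * Complex.I) ^ l * ((legendreP l).eval (y.1 2) : ℝ) := by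
  simp only [complexForm_axisRotation]
  refine integral_circle_pow_eq_legendreP (t := y.1 2) rfl ?_ l
  have h1 := isotropic_coords huv h0
  have h2 : (y.1 0) ^ 2 + (y.1 1) ^ 2 + (y.1 2) ^ 2 = 1 := by
    have : ‖y.1‖ ^ 2 = 1 := by rw [norm_eq_of_mem_sphere, one_pow]
    rw [EuclideanSpace.norm_sq_eq] at this
    simpa only [Fin.sum_univ_three, Real.norm_eq_abs, sq_abs] using this
  have h2' := congrArg (fun s : ℝ => (s : ℂ)) h2
  push_cast at h2'
  generalize (u 0 : ℂ) + v 0 * Complex.I = a at *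
  generalize (u 1 : ℂ) + v 1 * Complex.I = b at *
  generalize (u 2 : ℂ) + v 2 * Complex.I = c at *
  linear_combination ((y.1 0 : ℂ) ^ 2 + (y.1 1 : ℂ) ^ 2) * h1 - c ^ 2 * h2' +
    (b ^ 2 * (y.1 1) ^ 2 * (Complex.I ^ 2 - 1) - a ^ 2 * (y.1 1) ^ 2 - b ^ 2 * (y.1 0) ^ 2) *
      Complex.I_sq

/-- A kernel on `[-1, 1]` that is measurable and bounded. -/
def IsZonalKernel (k : ℝ → ℝ) : Prop :=
  Measurable k ∧ ∃ M, ∀ t ∈ Set.Icc (-1 : ℝ) 1, |k t| ≤ M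

theorem IsZonalKernel.exists_bound {k : ℝ → ℝ} (hk : IsZonalKernel k) :
    ∃ M, 0 ≤ M ∧ ∀ x y : S2, |k (inner ℝ x.1 y.1)| ≤ M := by
  obtain ⟨-, M, hM⟩ := hk
  exact ⟨M, (abs_nonneg _).trans (hM 0 (by norm_num)), fun x y => hM _ (inner_sphere_mem_Icc x y)⟩

theorem IsZonalKernel.measurable_uncurry {k : ℝ → ℝ} (hk : IsZonalKernel k) :
    Measurable fun p : S2 × S2 => k (inner ℝ p.1.1 p.2.1) := by
  have hc : Continuous fun p : S2 × S2 => inner ℝ p.1.1 p.2.1 := by fun_prop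
  exact hk.1.comp hc.measurable

theorem IsZonalKernel.measurable_right {k : ℝ → ℝ} (hk : IsZonalKernel k) (x : S2) :
    Measurable fun y : S2 => k (inner ℝ x.1 y.1) :=
  hk.measurable_uncurry.comp measurable_prodMk_left

/-- The north pole. -/
noncomputable def northPole : S2 := ⟨EuclideanSpace.single 2 1, by simp⟩

theorem inner_northPole (y : EuclideanSpace ℝ (Fin 3)) : inner ℝ northPole.1 y = y 2 := by
  simp [northPole, EuclideanSpace.inner_single_left]

theorem integral_comp_sphereMap (R : EuclideanSpace ℝ (Fin 3) ≃ₗᵢ[ℝ] EuclideanSpace ℝ (Fin 3))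
    {f : S2 → ℂ} (hf : Measurable f) :
    ∫ y, f (sphereMap R y) ∂surfaceMeasure = ∫ y, f y ∂surfaceMeasure := by
  have h := measurePreserving_sphereMap R
  conv_rhs => rw [← h.map_eq]
  rw [integral_map h.measurable.aemeasurable hf.aestronglyMeasurable]

/-- The kernel at the pole and the surface measure are invariant under rotations about the axis, so
the power may be replaced by its circle average. This average is `P_l(y₂)` times the value of the
power at the pole, and a zonal integral remains. -/
theorem integral_northPole_complexForm {u v : EuclideanSpace ℝ (Fin 3)} (huv : ‖u‖ = ‖v‖)
    (h0 : inner ℝ u v = 0) (l : ℕ) {k : ℝ → ℝ} (hk : IsZonalKernel k) :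
    ∫ y : S2, (k (inner ℝ northPole.1 y.1) : ℂ) * complexForm u v y.1 ^ l ∂surfaceMeasure =
      (2 * Real.pi * ∫ t in (-1 : ℝ)..1, k t * (legendreP l).eval t : ℝ) *
        complexForm u v northPole.1 ^ l := by
  obtain ⟨M, hM0, hM⟩ := hk.exists_bound
  have hkm : Measurable fun y : S2 => (k (inner ℝ northPole.1 y.1) : ℂ) :=
    Complex.measurable_ofReal.comp (hk.measurable_right northPole)
  let H : S2 → ℂ := fun y => (k (inner ℝ northPole.1 y.1) : ℂ) * complexForm u v y.1 ^ l
  have hH : Measurable H := hkm.mul ((continuous_complexForm u v).pow l).measurable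
  let G : ℝ → S2 → ℂ := fun φ y =>
    (k (inner ℝ northPole.1 y.1) : ℂ) * complexForm u v (axisRotation φ y.1) ^ l
  have hGH (φ : ℝ) (y : S2) : G φ y = H (sphereMap (axisRotation φ) y) := by
    simp only [G, H, sphereMap, inner_northPole]
    simp [axisRotation_apply]
  have hint : Integrable (Function.uncurry G)
      ((volume.restrict (Set.Ioc 0 (2 * Real.pi))).prod surfaceMeasure) := by
    refine Integrable.of_bound (C := M * (‖u‖ + ‖v‖) ^ l) ?_ (ae_of_all _ ?_)
    · have hc : Continuous fun p : ℝ × S2 => complexForm u v (axisRotation p.1 p.2.1) ^ l := by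
        simp only [complexForm_axisRotation]
        fun_prop
      exact ((hkm.comp measurable_snd).mul hc.measurable).aestronglyMeasurable
    · rintro ⟨φ, y⟩
      simp only [Function.uncurry_apply_pair, G, norm_mul, norm_pow, Complex.norm_real,
        Real.norm_eq_abs]
      gcongr
      · exact hM northPole y
      · exact norm_complexForm_le u v (sphereMap (axisRotation φ) y)
  have hswap : ∫ φ in (0 : ℝ)..2 * Real.pi, ∫ y, G φ y ∂surfaceMeasure =
      ∫ y, (∫ φ in (0 : ℝ)..2 * Real.pi, G φ y) ∂surfaceMeasure := by
    simp only [intervalIntegral.integral_of_le Real.two_pi_pos.le]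
    exact integral_integral_swap hint
  simp only [hGH, integral_comp_sphereMap _ hH, intervalIntegral.integral_const] at hswap
  have hinner (y : S2) : ∫ φ in (0 : ℝ)..2 * Real.pi, H (sphereMap (axisRotation φ) y) =
      ((2 * Real.pi : ℝ) * complexForm u v northPole.1 ^ l) *
        ((k (inner ℝ northPole.1 y.1) * (legendreP l).eval (inner ℝ northPole.1 y.1) : ℝ) : ℂ) := by
    simp only [← hGH, G]
    rw [intervalIntegral.integral_const_mul, integral_circle_complexForm huv h0]
    simp only [inner_northPole]
    rw [complexForm_eq_sum u v northPole.1]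
    simp [northPole]
    ring
  simp only [hinner] at hswap
  rw [integral_const_mul, integral_complex_ofReal, integral_zonal northPole
    (h := fun t => k t * (legendreP l).eval t)
    (hk.1.mul (legendreP l).continuous.measurable)] at hswap
  have hpi : ((2 * Real.pi : ℝ) : ℂ) ≠ 0 := by
    exact_mod_cast Real.two_pi_pos.ne'
  rw [sub_zero, Complex.real_smul, mul_assoc] at hswap
  rw [mul_left_cancel₀ hpi hswap, mul_comm]

/-- The Funk–Hecke formula for powers of isotropic linear forms. -/
theorem integral_zonal_mul_complexForm {u v : EuclideanSpace ℝ (Fin 3)} (huv : ‖u‖ = ‖v‖)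
    (h0 : inner ℝ u v = 0) (l : ℕ) {k : ℝ → ℝ} (hk : IsZonalKernel k) (x : S2) :
    ∫ y : S2, (k (inner ℝ x.1 y.1) : ℂ) * complexForm u v y.1 ^ l ∂surfaceMeasure =
      (2 * Real.pi * ∫ t in (-1 : ℝ)..1, k t * (legendreP l).eval t : ℝ) *
        complexForm u v x.1 ^ l := by
  obtain ⟨R, hR⟩ : ∃ R : EuclideanSpace ℝ (Fin 3) ≃ₗᵢ[ℝ] EuclideanSpace ℝ (Fin 3),
      R northPole.1 = x.1 := ⟨_, Submodule.reflection_sub (by simp)⟩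
  have hform (y : EuclideanSpace ℝ (Fin 3)) :
      complexForm u v (R y) = complexForm (R.symm u) (R.symm v) y := by
    simp only [complexForm]
    rw [← R.inner_map_map (R.symm u), ← R.inner_map_map (R.symm v)]
    simp
  have hm : Measurable fun y : S2 => (k (inner ℝ x.1 y.1) : ℂ) * complexForm u v y.1 ^ l :=
    (Complex.measurable_ofReal.comp (hk.measurable_right x)).mul
      ((continuous_complexForm u v).pow l).measurable
  rw [← integral_comp_sphereMap R hm, ← hR]
  simp only [sphereMap, LinearIsometryEquiv.inner_map_map, hform]
  exact integral_northPole_complexForm (by simpa using huv)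
    (by rw [← R.inner_map_map]; simpa using h0) l hk

theorem IsZonalKernel.integrable_mul {k : ℝ → ℝ} (hk : IsZonalKernel k) {f : S2 → ℂ}
    (hf : Continuous f) (x : S2) :
    Integrable (fun y : S2 => (k (inner ℝ x.1 y.1) : ℂ) * f y) surfaceMeasure := by
  obtain ⟨M, hM0, hM⟩ := hk.exists_bound
  refine Integrable.bdd_mul (c := M) (hf.integrable_of_hasCompactSupport
    (HasCompactSupport.of_compactSpace f)) ?_ (ae_of_all _ fun y => ?_)
  · exact (Complex.measurable_ofReal.comp (hk.measurable_right x)).aestronglyMeasurable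
  · simpa using hM x y

/-- The space of continuous functions on the sphere for which the Funk–Hecke formula holds with
the eigenvalues `2π ∫ k P_l`. -/
noncomputable def funkHeckeSpace (l : ℕ) : Submodule ℂ (S2 → ℂ) where
  carrier := {f | Continuous f ∧ ∀ k : ℝ → ℝ, IsZonalKernel k → ∀ x : S2,
    ∫ y : S2, (k (inner ℝ x.1 y.1) : ℂ) * f y ∂surfaceMeasure =
      (2 * Real.pi * ∫ t in (-1 : ℝ)..1, k t * (legendreP l).eval t : ℝ) * f x}
  zero_mem' := ⟨continuous_const, by simp⟩
  add_mem' := by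
    rintro f g ⟨hf, hf'⟩ ⟨hg, hg'⟩
    refine ⟨hf.add hg, fun k hk x => ?_⟩
    simp only [Pi.add_apply, mul_add]
    rw [integral_add (hk.integrable_mul hf x) (hk.integrable_mul hg x), hf' k hk, hg' k hk]
  smul_mem' := by
    rintro c f ⟨hf, hf'⟩
    refine ⟨hf.const_smul c, fun k hk x => ?_⟩
    simp only [Pi.smul_apply, smul_eq_mul, mul_left_comm _ c]
    rw [integral_const_mul, hf' k hk]

theorem complexForm_pow_mem_funkHeckeSpace {u v : EuclideanSpace ℝ (Fin 3)} (huv : ‖u‖ = ‖v‖)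
    (h0 : inner ℝ u v = 0) (l : ℕ) :
    (fun y : S2 => complexForm u v y.1 ^ l) ∈ funkHeckeSpace l :=
  ⟨(continuous_complexForm u v).pow l,
    fun _ hk x => integral_zonal_mul_complexForm huv h0 l hk x⟩

/-! ### The spherical harmonics satisfy the Funk–Hecke formula -/

/-- Evaluating at the nodes `0, …, n-1` gives an invertible Vandermonde system, so every coefficient
is a combination of values. -/
theorem Submodule.mem_of_forall_sum_pow_smul_mem {V : Type*} [AddCommGroup V] [Module ℂ V]
    (W : Submodule ℂ V) {n : ℕ} (c : ℕ → V)
    (h : ∀ u : ℝ, ∑ k ∈ Finset.range n, (u : ℂ) ^ k • c k ∈ W) {j : ℕ} (hj : j < n) :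
    c j ∈ W := by
  let A : Matrix (Fin n) (Fin n) ℂ := Matrix.vandermonde fun i : Fin n => ((i : ℝ) : ℂ)
  have hA : IsUnit A.det := by
    refine isUnit_iff_ne_zero.2 (Matrix.det_vandermonde_ne_zero_iff.2 fun i k hik => ?_)
    exact Fin.ext (by exact_mod_cast hik)
  have hinv : A⁻¹ * A = 1 := Matrix.nonsing_inv_mul A hA
  have key : c j = ∑ i : Fin n, A⁻¹ ⟨j, hj⟩ i • ∑ k : Fin n, A i k • c k := by
    simp only [Finset.smul_sum, smul_smul]
    rw [Finset.sum_comm]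
    simp only [← Finset.sum_smul, ← Matrix.mul_apply, hinv, Matrix.one_apply, ite_smul, one_smul,
      zero_smul, Finset.sum_ite_eq, Finset.mem_univ, if_true]
  rw [key]
  refine W.sum_mem fun i _ => W.smul_mem _ ?_
  have := h i
  rw [Finset.sum_range] at this
  simpa only [A, Matrix.vandermonde_apply] using this

open Polynomial in
theorem coeff_taylor_one_sub_sq_pow (l k : ℕ) (t : ℝ) :
    (taylor t ((1 - X ^ 2) ^ l)).coeff k =
      (derivative^[k] ((1 - X ^ 2) ^ l : ℝ[X])).eval t / (k.factorial : ℝ) := by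
  rw [taylor_coeff, ← factorial_smul_hasseDeriv]
  have : (k.factorial : ℝ) ≠ 0 := by exact_mod_cast k.factorial_ne_zero
  simp [mul_div_cancel_left₀ _ this]

-- Expand `(1 - s²)^l` around `t` with increment `uz`: since `z z̄ = 1 - t²`, it equals `z^l (z̄ -
-- 2tu - u²z)^l`, and dividing by `z^l` gives the claim.
open Polynomial in
theorem sum_derivative_one_sub_sq_pow {t : ℝ} {z : ℂ}
    (hz : z * (starRingEnd ℂ) z = 1 - (t : ℂ) ^ 2) (l : ℕ) (u : ℂ) :
    ∑ k ∈ Finset.range (2 * l + 1), u ^ k *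
      (((taylor t ((1 - X ^ 2) ^ l)).coeff k : ℂ) * z ^ ((k : ℤ) - l)) =
      ((starRingEnd ℂ) z - 2 * t * u - u ^ 2 * z) ^ l := by
  have hT : taylor t ((1 - X ^ 2) ^ l) = (1 - (X + C t) ^ 2) ^ l := by
    simp [taylor_apply]
  -- At the poles division is impossible. There `0 ^ (k - l)` is `0` unless `k = l`, negative
  -- exponents included, so only the coefficient of index `l` survives.
  rcases eq_or_ne z 0 with rfl | hz0
  · have ht : t ^ 2 = 1 := by
      have : ((t ^ 2 : ℝ) : ℂ) = 1 := by
        push_cast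
        linear_combination hz
      exact_mod_cast this
    rw [Finset.sum_eq_single_of_mem l (Finset.mem_range.2 (by omega))]
    · have hT' : taylor t ((1 - X ^ 2) ^ l) = X ^ l * (C (-2 * t) - X) ^ l := by
        rw [hT, ← mul_pow]
        congr 1
        have : (C t : ℝ[X]) ^ 2 = 1 := by rw [← C_pow, ht, C_1]
        simp only [map_mul, map_neg, C_ofNat]
        linear_combination -this
      have hc : (taylor t ((1 - X ^ 2) ^ l)).coeff l = (-2 * t) ^ l := by
        rw [hT', coeff_X_pow_mul', if_pos le_rfl, Nat.sub_self, coeff_zero_eq_eval_zero]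
        simp
      rw [hc]
      simp only [sub_self, zpow_zero, mul_one, map_zero, mul_zero, sub_zero, zero_sub]
      push_cast
      rw [← mul_pow]
      congr 1
      ring
    · intro k _ hk
      rw [zero_zpow _ (by omega), mul_zero, mul_zero]
  · apply mul_left_cancel₀ (pow_ne_zero l hz0)
    have h1 : aeval (u * z) (taylor t ((1 - X ^ 2) ^ l)) = (1 - (u * z + t) ^ 2) ^ l := by
      rw [hT]
      simp
    have hdeg : (taylor t ((1 - X ^ 2 : ℝ[X]) ^ l)).natDegree < 2 * l + 1 := by
      rw [natDegree_taylor]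
      refine Nat.lt_succ_of_le (natDegree_pow_le.trans ?_)
      rw [mul_comm]
      gcongr
      compute_degree
    rw [aeval_eq_sum_range' hdeg] at h1
    rw [← mul_pow]
    calc _ = ∑ k ∈ Finset.range (2 * l + 1),
        (taylor t ((1 - X ^ 2) ^ l)).coeff k • (u * z) ^ k := by
          rw [Finset.mul_sum]
          refine Finset.sum_congr rfl fun k _ => ?_
          rw [zpow_sub₀ hz0, zpow_natCast, zpow_natCast, Complex.real_smul, mul_pow]
          field_simp
      _ = _ := by
          rw [h1]
          congr 1
          linear_combination -hz

theorem sphere_coord_mul_conj (x : S2) :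
    (⟨x.1 0, x.1 1⟩ : ℂ) * (starRingEnd ℂ) ⟨x.1 0, x.1 1⟩ = 1 - (x.1 2 : ℂ) ^ 2 := by
  have h2 : (x.1 0) ^ 2 + (x.1 1) ^ 2 + (x.1 2) ^ 2 = 1 := by
    have : ‖x.1‖ ^ 2 = 1 := by rw [norm_eq_of_mem_sphere, one_pow]
    rw [EuclideanSpace.norm_sq_eq] at this
    simpa only [Fin.sum_univ_three, Real.norm_eq_abs, sq_abs] using this
  have h2' := congrArg (fun s : ℝ => (s : ℂ)) h2
  push_cast at h2'
  rw [Complex.mul_conj, Complex.normSq_mk]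
  push_cast
  linear_combination h2'

open Polynomial in
theorem taylor_coeff_mul_zpow_mem_funkHeckeSpace {l k : ℕ} (hk : k ≤ 2 * l) :
    (fun x : S2 => ((taylor (x.1 2) ((1 - X ^ 2) ^ l)).coeff k : ℂ) *
      (⟨x.1 0, x.1 1⟩ : ℂ) ^ ((k : ℤ) - l)) ∈ funkHeckeSpace l := by
  refine Submodule.mem_of_forall_sum_pow_smul_mem (n := 2 * l + 1) (funkHeckeSpace l)
    (fun k (x : S2) => ((taylor (x.1 2) ((1 - X ^ 2) ^ l)).coeff k : ℂ) *
      (⟨x.1 0, x.1 1⟩ : ℂ) ^ ((k : ℤ) - l)) (fun u => ?_) (by omega)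
  -- With `z = x₀ + i x₁` and `t = x₂`, these two vectors give the isotropic form `z̄ - 2tu - u²z`
  -- of the generating identity.
  have huv : ‖(!₂[1 - u ^ 2, 0, -2 * u] : EuclideanSpace ℝ (Fin 3))‖ =
      ‖(!₂[0, -(1 + u ^ 2), 0] : EuclideanSpace ℝ (Fin 3))‖ := by
    simp only [EuclideanSpace.norm_eq, Fin.sum_univ_three, Real.norm_eq_abs, sq_abs]
    congr 1
    simp
    ring
  have h0 : inner ℝ (!₂[1 - u ^ 2, 0, -2 * u] : EuclideanSpace ℝ (Fin 3))
      !₂[0, -(1 + u ^ 2), 0] = 0 := by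
    simp [PiLp.inner_apply, Fin.sum_univ_three]
  convert complexForm_pow_mem_funkHeckeSpace huv h0 l using 1
  ext x
  simp only [Finset.sum_apply, Pi.smul_apply, smul_eq_mul]
  rw [sum_derivative_one_sub_sq_pow (sphere_coord_mul_conj x), complexForm_eq_sum]
  congr 1
  apply Complex.ext <;> simp [pow_two] <;> ring

/-- Since `√(1 - t²)^m e^{imφ} = z^m`, the harmonic is a constant multiple of the Taylor coefficient
of index `k = l + m` times `z^(k - l)`. The poles need no separate treatment, as both powers follow
the same convention at `0`. -/
theorem sphericalHarmonic_mem_funkHeckeSpace {l : ℕ} {m : ℤ} (hm : |m| ≤ (l : ℤ)) :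
    sphericalHarmonic l m ∈ funkHeckeSpace l := by
  obtain ⟨hm1, hm2⟩ := abs_le.1 hm
  obtain ⟨k, hk⟩ : ∃ k : ℕ, m + l = k := ⟨(m + l).toNat, by omega⟩
  have hkl : k ≤ 2 * l := by omega
  have hmk : (k : ℤ) - l = m := by omega
  have key := Submodule.smul_mem _ (((√((2 * (l : ℝ) + 1) / (4 * Real.pi) *
      (((l - m).toNat.factorial : ℝ) / ((l + m).toNat.factorial : ℝ))) *
      ((-1) ^ k / (2 ^ l * (l.factorial : ℝ)) * (k.factorial : ℝ)) : ℝ) : ℂ))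
    (taylor_coeff_mul_zpow_mem_funkHeckeSpace hkl)
  convert key using 1
  ext x
  have hk0 : (k.factorial : ℝ) ≠ 0 := by exact_mod_cast k.factorial_ne_zero
  have hnorm : √(1 - x.1 2 ^ 2) = ‖(⟨x.1 0, x.1 1⟩ : ℂ)‖ := by
    rw [← Real.sqrt_sq (norm_nonneg _)]
    congr 1
    have := sphere_coord_mul_conj x
    rw [Complex.mul_conj'] at this
    exact_mod_cast this.symm
  have hz : (⟨x.1 0, x.1 1⟩ : ℂ) ^ m = ((‖(⟨x.1 0, x.1 1⟩ : ℂ)‖ ^ m : ℝ) : ℂ) *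
      Complex.exp (Complex.I * (m : ℂ) * (Complex.arg ⟨x.1 0, x.1 1⟩ : ℂ)) := by
    conv_lhs => rw [← Complex.norm_mul_exp_arg_mul_I ⟨x.1 0, x.1 1⟩]
    rw [mul_zpow, ← Complex.exp_int_mul]
    push_cast
    congr 2
    ring
  simp only [sphericalHarmonic, assocLegendre, Pi.smul_apply, smul_eq_mul, hk, Int.toNat_natCast,
    hmk, hz, hnorm, coeff_taylor_one_sub_sq_pow]
  generalize Complex.exp _ = e
  generalize ‖(⟨x.1 0, x.1 1⟩ : ℂ)‖ ^ m = s
  generalize Polynomial.eval (R := ℝ) _ _ = q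
  have hk0' : (k.factorial : ℂ) ≠ 0 := by exact_mod_cast k.factorial_ne_zero
  push_cast
  field_simp

theorem exists_sum_of_mem_bandLimited {L : ℕ} {f : S2 → ℂ} (hf : f ∈ bandLimited L) :
    ∃ F : ℕ → S2 → ℂ, (∀ l, F l ∈ funkHeckeSpace l) ∧ f = ∑ l ∈ Finset.range (L + 1), F l := by
  have hle : bandLimited L ≤ ⨆ l ∈ Finset.range (L + 1), funkHeckeSpace l := by
    refine Submodule.span_le.2 ?_
    rintro _ ⟨l, hl, m, hm, rfl⟩
    exact Submodule.mem_iSup_of_mem l (Submodule.mem_iSup_of_mem (Finset.mem_range.2 (by omega))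
      (sphericalHarmonic_mem_funkHeckeSpace hm))
  obtain ⟨F, hF⟩ := (Submodule.mem_iSup_finset_iff_exists_sum _ _).1 (hle hf)
  exact ⟨fun l => F l, fun l => (F l).2, hF.symm⟩

/-! ### Orthogonality and reproducing kernels -/

/-- The eigenvalue on spherical harmonics of degree `l` of the convolution operator with the
zonal kernel `k`. -/
noncomputable def funkHeckeEigenvalue (k : ℝ → ℝ) (l : ℕ) : ℝ :=
  2 * Real.pi * ∫ t in (-1 : ℝ)..1, k t * (legendreP l).eval t

theorem integrable_of_continuous_sphere {E : Type*} [NormedAddCommGroup E] {f : S2 → E}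
    (hf : Continuous f) : Integrable f surfaceMeasure :=
  hf.integrable_of_hasCompactSupport (HasCompactSupport.of_compactSpace f)

theorem integral_zonal_mul_mul_swap {k : ℝ → ℝ} (hk : IsZonalKernel k) {f g : S2 → ℂ}
    (hf : Continuous f) (hg : Continuous g) :
    ∫ x, g x * ∫ y, (k (inner ℝ x.1 y.1) : ℂ) * f y ∂surfaceMeasure ∂surfaceMeasure =
      ∫ y, f y * ∫ x, (k (inner ℝ y.1 x.1) : ℂ) * g x ∂surfaceMeasure ∂surfaceMeasure := by
  obtain ⟨M, hM0, hM⟩ := hk.exists_bound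
  have hint : Integrable (fun p : S2 × S2 => (k (inner ℝ p.1.1 p.2.1) : ℂ) * (g p.1 * f p.2))
      (surfaceMeasure.prod surfaceMeasure) := by
    refine Integrable.bdd_mul (c := M)
      ((integrable_of_continuous_sphere hg).mul_prod (integrable_of_continuous_sphere hf))
      ?_ (ae_of_all _ fun p => ?_)
    · exact (Complex.measurable_ofReal.comp hk.measurable_uncurry).aestronglyMeasurable
    · simpa using hM p.1 p.2
  simp only [← integral_const_mul]
  have h1 (x y : S2) : g x * ((k (inner ℝ x.1 y.1) : ℂ) * f y) =
      (k (inner ℝ x.1 y.1) : ℂ) * (g x * f y) := by ring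
  have h2 (x y : S2) : f y * ((k (inner ℝ y.1 x.1) : ℂ) * g x) =
      (k (inner ℝ x.1 y.1) : ℂ) * (g x * f y) := by
    rw [real_inner_comm]
    ring
  simp only [h1, h2]
  exact integral_integral_swap hint

theorem integral_mul_conj_eq_zero {l m : ℕ} (hlm : l ≠ m) {f g : S2 → ℂ}
    (hf : f ∈ funkHeckeSpace l) (hg : g ∈ funkHeckeSpace m) :
    ∫ x, f x * (starRingEnd ℂ) (g x) ∂surfaceMeasure = 0 := by
  have hcl := (legendreP l).continuous
  have hcm := (legendreP m).continuous
  -- Convolution with a real zonal kernel is symmetric, so distinct eigenvalues force orthogonality.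
  -- For this kernel the eigenvalues of degrees `l` and `m` differ by `2π ∫ (P_l - P_m)² > 0`.
  let k : ℝ → ℝ := fun t => (legendreP l).eval t - (legendreP m).eval t
  have hkc : Continuous k := hcl.sub hcm
  have hk : IsZonalKernel k := by
    obtain ⟨M, hM⟩ := isCompact_Icc.exists_bound_of_continuousOn (s := Set.Icc (-1 : ℝ) 1)
      hkc.continuousOn
    exact ⟨hkc.measurable, M, hM⟩
  have hg' (y : S2) : ∫ x, (k (inner ℝ y.1 x.1) : ℂ) * (starRingEnd ℂ) (g x) ∂surfaceMeasure =
      (funkHeckeEigenvalue k m : ℂ) * (starRingEnd ℂ) (g y) := by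
    have := congrArg (starRingEnd ℂ) (hg.2 k hk y)
    rw [← integral_conj] at this
    simpa only [map_mul, Complex.conj_ofReal, funkHeckeEigenvalue] using this
  have hswap := integral_zonal_mul_mul_swap hk hf.1 (Complex.continuous_conj.comp hg.1)
  simp only [Function.comp_apply, hf.2 k hk, hg'] at hswap
  have h1 (x : S2) : (starRingEnd ℂ) (g x) *
      ((2 * Real.pi * ∫ t in (-1 : ℝ)..1, k t * (legendreP l).eval t : ℝ) * f x) =
      (funkHeckeEigenvalue k l : ℂ) * (f x * (starRingEnd ℂ) (g x)) := by
    rw [funkHeckeEigenvalue]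
    ring
  have h2 (x : S2) : f x * ((funkHeckeEigenvalue k m : ℂ) * (starRingEnd ℂ) (g x)) =
      (funkHeckeEigenvalue k m : ℂ) * (f x * (starRingEnd ℂ) (g x)) := by ring
  simp only [h1, h2] at hswap
  rw [integral_const_mul, integral_const_mul, ← sub_eq_zero, ← sub_mul] at hswap
  refine (mul_eq_zero.1 hswap).resolve_left ?_
  have hdiff : funkHeckeEigenvalue k l - funkHeckeEigenvalue k m =
      2 * Real.pi * ∫ t in (-1 : ℝ)..1, k t ^ 2 := by
    rw [funkHeckeEigenvalue, funkHeckeEigenvalue, ← mul_sub, ← intervalIntegral.integral_sub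
      (Continuous.intervalIntegrable (by fun_prop) _ _)
      (Continuous.intervalIntegrable (by fun_prop) _ _)]
    congr 2
    ext t
    simp only [k]
    ring
  have hpos := integral_legendreP_sub_sq_pos hlm
  rw [← Complex.ofReal_sub, hdiff]
  exact_mod_cast (mul_pos Real.two_pi_pos hpos).ne'

theorem integral_norm_sq_sum {F : ℕ → S2 → ℂ} (hF : ∀ l, F l ∈ funkHeckeSpace l)
    (s : Finset ℕ) :
    ∫ x, ‖∑ l ∈ s, F l x‖ ^ 2 ∂surfaceMeasure =
      ∑ l ∈ s, ∫ x, ‖F l x‖ ^ 2 ∂surfaceMeasure := by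
  have hint (l m : ℕ) : Integrable (fun x => F l x * (starRingEnd ℂ) (F m x)) surfaceMeasure :=
    integrable_of_continuous_sphere ((hF l).1.mul (Complex.continuous_conj.comp (hF m).1))
  have hsq (z : ℂ) : ((‖z‖ ^ 2 : ℝ) : ℂ) = z * (starRingEnd ℂ) z := by
    rw [Complex.mul_conj']
    push_cast
    rfl
  apply Complex.ofReal_injective
  rw [← integral_complex_ofReal, Complex.ofReal_sum]
  simp only [← integral_complex_ofReal, hsq, map_sum, Finset.sum_mul_sum]
  rw [integral_finsetSum _ fun l _ => integrable_finsetSum _ fun m _ => hint l m]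
  refine Finset.sum_congr rfl fun l hl => ?_
  rw [integral_finsetSum _ fun m _ => hint l m]
  exact Finset.sum_eq_single_of_mem l hl fun m _ hml =>
    integral_mul_conj_eq_zero hml.symm (hF l) (hF m)

theorem lintegral_enorm_sq_eq_ofReal_integral {f : S2 → ℂ} (hf : Continuous f) :
    ∫⁻ x, ‖f x‖ₑ ^ 2 ∂surfaceMeasure = ENNReal.ofReal (∫ x, ‖f x‖ ^ 2 ∂surfaceMeasure) := by
  rw [ofReal_integral_eq_lintegral_ofReal
    (integrable_of_continuous_sphere (by fun_prop)) (ae_of_all _ fun x => by positivity)]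
  simp only [ENNReal.ofReal_pow (norm_nonneg _), ofReal_norm]

theorem lintegral_mul_sq_le {α : Type*} [MeasurableSpace α] (μ : Measure α) {f g : α → ℝ≥0∞}
    (hf : AEMeasurable f μ) (hg : AEMeasurable g μ) :
    (∫⁻ x, f x * g x ∂μ) ^ 2 ≤ (∫⁻ x, f x ^ 2 ∂μ) * ∫⁻ x, g x ^ 2 ∂μ := by
  have h := ENNReal.lintegral_mul_le_Lp_mul_Lq μ Real.HolderConjugate.two_two hf hg
  have h2 := pow_le_pow_left' h 2
  simpa only [Pi.mul_apply, mul_pow, ← ENNReal.rpow_natCast, ← ENNReal.rpow_mul, Nat.cast_ofNat,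
    ne_eq, OfNat.ofNat_ne_zero, not_false_eq_true, one_div, inv_mul_cancel₀, ENNReal.rpow_one]
    using h2

/-! ### The truncated Legendre kernel -/

/-- The Legendre polynomial `P_L` truncated to the interval `[δ, 1]`. -/
noncomputable def truncatedLegendre (L : ℕ) (δ : ℝ) : ℝ → ℝ :=
  (Set.Icc δ 1).indicator fun t => (legendreP L).eval t

theorem isZonalKernel_truncatedLegendre (L : ℕ) (δ : ℝ) :
    IsZonalKernel (truncatedLegendre L δ) := by
  obtain ⟨M, hM⟩ := isCompact_Icc.exists_bound_of_continuousOn (s := Set.Icc (-1 : ℝ) 1)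
    (legendreP L).continuous.continuousOn
  refine ⟨(legendreP L).continuous.measurable.indicator measurableSet_Icc, M, fun t ht => ?_⟩
  exact (norm_indicator_le_norm_self (fun t => (legendreP L).eval t) t).trans (hM t ht)

theorem integral_truncatedLegendre_mul (L : ℕ) {δ : ℝ} (h0 : -1 ≤ δ) (h1 : δ ≤ 1) (g : ℝ → ℝ) :
    ∫ t in (-1 : ℝ)..1, truncatedLegendre L δ t * g t =
      ∫ t in δ..1, (legendreP L).eval t * g t := by
  have h : (fun t => truncatedLegendre L δ t * g t) =
      (Set.Icc δ 1).indicator fun t => (legendreP L).eval t * g t := by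
    ext t
    simp only [truncatedLegendre, Set.indicator_apply]
    split_ifs <;> simp
  rw [h, intervalIntegral.integral_of_le (by norm_num), intervalIntegral.integral_of_le h1,
    ← integral_Icc_eq_integral_Ioc, ← integral_Icc_eq_integral_Ioc,
    setIntegral_indicator measurableSet_Icc,
    Set.inter_eq_right.2 (Set.Icc_subset_Icc_left h0)]

theorem lintegral_truncatedLegendre_sq (L : ℕ) {δ : ℝ} (h0 : -1 ≤ δ) (h1 : δ ≤ 1) (x : S2) :
    ∫⁻ y : S2, ‖truncatedLegendre L δ (inner ℝ x.1 y.1)‖ₑ ^ 2 ∂surfaceMeasure =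
      ENNReal.ofReal (2 * Real.pi * ∫ t in δ..1, (legendreP L).eval t ^ 2) := by
  have hk := isZonalKernel_truncatedLegendre L δ
  obtain ⟨M, hM0, hM⟩ := hk.exists_bound
  have hsq : ∫ t in (-1 : ℝ)..1, truncatedLegendre L δ t ^ 2 =
      ∫ t in δ..1, (legendreP L).eval t ^ 2 := by
    simp only [sq]
    rw [integral_truncatedLegendre_mul L h0 h1]
    refine intervalIntegral.integral_congr fun t ht => ?_
    rw [Set.uIcc_of_le h1] at ht
    simp [truncatedLegendre, ht]
  rw [← hsq, ← integral_zonal x (h := fun t => truncatedLegendre L δ t ^ 2) (hk.1.pow_const 2),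
    ofReal_integral_eq_lintegral_ofReal _ (ae_of_all _ fun y => by positivity)]
  · refine lintegral_congr fun y => ?_
    rw [← sq_abs, ENNReal.ofReal_pow (abs_nonneg _), ← Real.norm_eq_abs, ofReal_norm]
  · refine Integrable.of_bound (C := M ^ 2)
      ((hk.measurable_right x).pow_const 2).aestronglyMeasurable (ae_of_all _ fun y => ?_)
    rw [norm_pow, Real.norm_eq_abs]
    gcongr
    exact hM x y

/-- Divide the component of degree `l` by its eigenvalue, which is at least `a`; orthogonality turns
the bound on each component into one on the sum. -/
theorem exists_truncatedLegendre_preimage {L : ℕ} (hL : 1 ≤ L) {δ : ℝ}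
    (hδ : largestZero L ≤ δ) (hδ1 : δ < 1) {f : S2 → ℂ} (hf : f ∈ bandLimited L) :
    Continuous f ∧ ∃ g : S2 → ℂ, Continuous g ∧
      (∀ x, ∫ y, (truncatedLegendre L δ (inner ℝ x.1 y.1) : ℂ) * g y ∂surfaceMeasure = f x) ∧
      ∫ x, ‖g x‖ ^ 2 ∂surfaceMeasure ≤
        (2 * Real.pi * ∫ t in δ..1, (legendreP L).eval t ^ 2)⁻¹ ^ 2 *
          ∫ x, ‖f x‖ ^ 2 ∂surfaceMeasure := by
  obtain ⟨F, hF, rfl⟩ := exists_sum_of_mem_bandLimited hf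
  have hδ0 : -1 ≤ δ := by linarith [(legendreP_largestZero hL).1]
  have hk := isZonalKernel_truncatedLegendre L δ
  set a := 2 * Real.pi * ∫ t in δ..1, (legendreP L).eval t ^ 2 with ha
  have ha0 : 0 < a := mul_pos Real.two_pi_pos (integral_legendreP_sq_pos L hδ1)
  let c : ℕ → ℝ := funkHeckeEigenvalue (truncatedLegendre L δ)
  have hc {l : ℕ} (hl : l ∈ Finset.range (L + 1)) : a ≤ c l := by
    simp only [c, funkHeckeEigenvalue, ha, integral_truncatedLegendre_mul L hδ0 hδ1.le]
    exact mul_le_mul_of_nonneg_left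
      (integral_legendreP_sq_le hL (by have := Finset.mem_range.1 hl; omega) hδ hδ1)
      Real.two_pi_pos.le
  -- The eigenvalues are controlled only for `l ≤ L`; the sums below use no other `G l`.
  let G : ℕ → S2 → ℂ := fun l => ((c l)⁻¹ : ℂ) • F l
  have hG (l : ℕ) : G l ∈ funkHeckeSpace l := Submodule.smul_mem _ _ (hF l)
  refine ⟨?_, fun x => ∑ l ∈ Finset.range (L + 1), G l x, ?_, fun x => ?_, ?_⟩
  · rw [Finset.sum_fn]
    exact continuous_finsetSum _ fun l _ => (hF l).1
  · exact continuous_finsetSum _ fun l _ => (hG l).1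
  · simp only [Finset.mul_sum]
    rw [integral_finsetSum _ fun l _ => hk.integrable_mul (hG l).1 x, Finset.sum_apply]
    refine Finset.sum_congr rfl fun l hl => ?_
    have hcl : (c l : ℂ) ≠ 0 := by exact_mod_cast (ha0.trans_le (hc hl)).ne'
    rw [(hG l).2 _ hk x]
    exact mul_inv_cancel_left₀ hcl (F l x)
  · simp only [Finset.sum_apply]
    rw [integral_norm_sq_sum hG, integral_norm_sq_sum hF, Finset.mul_sum]
    refine Finset.sum_le_sum fun l hl => ?_
    simp only [G, Pi.smul_apply, smul_eq_mul, norm_mul, mul_pow]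
    rw [integral_const_mul]
    refine mul_le_mul_of_nonneg_right ?_ (integral_nonneg fun x => by positivity)
    rw [← Complex.ofReal_inv, Complex.norm_real, Real.norm_eq_abs,
      abs_of_pos (inv_pos.2 (ha0.trans_le (hc hl)))]
    have := inv_anti₀ ha0 (hc hl)
    have := inv_nonneg.2 (ha0.le.trans (hc hl))
    gcongr

/-! ### The large sieve inequality -/

theorem measurableSet_sphericalCap (δ : ℝ) (x : S2) : MeasurableSet (sphericalCap δ x) := by
  have hc : Continuous fun y : S2 => inner ℝ x.1 y.1 := by fun_prop
  exact measurableSet_le measurable_const hc.measurable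

theorem lintegral_enorm_sq_le_of_mem_bandLimited {L : ℕ} (hL : 1 ≤ L) (μ : Measure S2)
    [SigmaFinite μ] {δ : ℝ} (hδ : largestZero L ≤ δ) (hδ1 : δ < 1) {f : S2 → ℂ}
    (hf : f ∈ bandLimited L) :
    ∫⁻ x, ‖f x‖ₑ ^ 2 ∂μ ≤
      ENNReal.ofReal ((2 * Real.pi * ∫ t in δ..1, (legendreP L).eval t ^ 2)⁻¹) *
        (∫⁻ x, ‖f x‖ₑ ^ 2 ∂surfaceMeasure) * ⨆ y : S2, μ (sphericalCap δ y) := by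
  obtain ⟨hfc, g, hg, hfg, hle⟩ := exists_truncatedLegendre_preimage hL hδ hδ1 hf
  have hδ0 : -1 ≤ δ := by linarith [(legendreP_largestZero hL).1]
  have hk := isZonalKernel_truncatedLegendre L δ
  have hsq := lintegral_truncatedLegendre_sq L hδ0 hδ1.le
  set a := 2 * Real.pi * ∫ t in δ..1, (legendreP L).eval t ^ 2
  have ha0 : 0 < a := mul_pos Real.two_pi_pos (integral_legendreP_sq_pos L hδ1)
  let S : Set (S2 × S2) := {p | δ ≤ inner ℝ p.1.1 p.2.1}
  have hS : MeasurableSet S := by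
    have hc : Continuous fun p : S2 × S2 => inner ℝ p.1.1 p.2.1 := by fun_prop
    exact measurableSet_le measurable_const hc.measurable
  -- Cutting `g` to the cap around `x` loses nothing against the kernel, which vanishes outside it.
  -- The cut is kept through Cauchy–Schwarz, so that integrating in `x` produces `μ (sphericalCap δ
  -- y)`.
  let H : S2 × S2 → ℝ≥0∞ := S.indicator fun p => ‖g p.2‖ₑ
  have hH : Measurable H := ((hg.comp continuous_snd).enorm.measurable).indicator hS
  have hpt (x : S2) : ‖f x‖ₑ ^ 2 ≤ ENNReal.ofReal a * ∫⁻ y, H (x, y) ^ 2 ∂surfaceMeasure := by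
    rw [← hsq x]
    refine le_trans ?_ (lintegral_mul_sq_le surfaceMeasure
      (hk.measurable_right x).enorm.aemeasurable (hH.comp measurable_prodMk_left).aemeasurable)
    gcongr
    rw [← hfg x]
    refine (enorm_integral_le_lintegral_enorm _).trans_eq (lintegral_congr fun y => ?_)
    rw [enorm_mul]
    by_cases hxy : δ ≤ inner ℝ x.1 y.1
    · have : H (x, y) = ‖g y‖ₑ := Set.indicator_of_mem (s := S) hxy _
      rw [this]
      simp [← ofReal_norm]
    · have hxy' : inner ℝ x.1 y.1 ∉ Set.Icc δ 1 := fun h => hxy h.1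
      simp [truncatedLegendre, hxy']
  have hinner (y : S2) : ∫⁻ x, H (x, y) ^ 2 ∂μ = ‖g y‖ₑ ^ 2 * μ (sphericalCap δ y) := by
    rw [← lintegral_indicator_const (measurableSet_sphericalCap δ y)]
    refine lintegral_congr fun x => ?_
    by_cases hxy : δ ≤ inner ℝ x.1 y.1
    · have h1 : H (x, y) = ‖g y‖ₑ := Set.indicator_of_mem (s := S) hxy _
      have h2 : x ∈ sphericalCap δ y := by
        rw [real_inner_comm] at hxy
        exact hxy
      rw [h1, Set.indicator_of_mem h2]
    · have h1 : H (x, y) = 0 := Set.indicator_of_notMem (s := S) hxy _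
      have h2 : x ∉ sphericalCap δ y := fun h => hxy (by rw [real_inner_comm]; exact h)
      rw [h1, Set.indicator_of_notMem h2, zero_pow two_ne_zero]
  calc ∫⁻ x, ‖f x‖ₑ ^ 2 ∂μ
      ≤ ∫⁻ x, ENNReal.ofReal a * ∫⁻ y, H (x, y) ^ 2 ∂surfaceMeasure ∂μ := lintegral_mono hpt
    _ = ENNReal.ofReal a * ∫⁻ y, ‖g y‖ₑ ^ 2 * μ (sphericalCap δ y) ∂surfaceMeasure := by
        rw [lintegral_const_mul' _ _ ENNReal.ofReal_ne_top,
          lintegral_lintegral_swap (hH.pow_const 2).aemeasurable]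
        simp only [hinner]
    _ ≤ ENNReal.ofReal a * ∫⁻ y, ‖g y‖ₑ ^ 2 * (⨆ y : S2, μ (sphericalCap δ y)) ∂surfaceMeasure := by
        gcongr with y
        exact le_iSup (fun y : S2 => μ (sphericalCap δ y)) y
    _ = ENNReal.ofReal a * (∫⁻ y, ‖g y‖ₑ ^ 2 ∂surfaceMeasure) *
          ⨆ y : S2, μ (sphericalCap δ y) := by
        rw [lintegral_mul_const _ (hg.enorm.measurable.pow_const 2), mul_assoc]
    _ ≤ _ := by
        -- The factor `a` from the kernel meets `a⁻²` from the bound on `g`, leaving `a⁻¹`.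
        refine mul_le_mul_left ?_ _
        rw [lintegral_enorm_sq_eq_ofReal_integral hg, lintegral_enorm_sq_eq_ofReal_integral hfc,
          ← ENNReal.ofReal_mul ha0.le, ← ENNReal.ofReal_mul (inv_nonneg.2 ha0.le)]
        refine ENNReal.ofReal_le_ofReal ((mul_le_mul_of_nonneg_left hle ha0.le).trans_eq ?_)
        field_simp

theorem surfaceMeasure_sphericalCap {δ : ℝ} (h0 : -1 ≤ δ) (y : S2) :
    surfaceMeasure (sphericalCap δ y) = ENNReal.ofReal (2 * Real.pi * (1 - δ)) := by
  have hc : Continuous fun x : S2 => inner ℝ y.1 x.1 := by fun_prop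
  have : sphericalCap δ y = (fun x : S2 => inner ℝ y.1 x.1) ⁻¹' Set.Ici δ := rfl
  have hset : Set.Ici δ ∩ Set.Icc (-1) 1 = Set.Icc δ 1 := by
    ext t
    exact ⟨fun h => ⟨h.1, h.2.2⟩, fun h => ⟨h.1, h0.trans h.1, h.2⟩⟩
  rw [this, ← Measure.map_apply hc.measurable measurableSet_Ici, map_inner_surfaceMeasure,
    Measure.smul_apply, Measure.restrict_apply measurableSet_Ici, hset,
    Real.volume_Icc, smul_eq_mul,
    ENNReal.ofReal_mul (p := 2 * Real.pi) (by positivity)]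

theorem mainTheorem1 (L : ℕ) (hL : 1 ≤ L) :
    (∀ (μ : Measure S2) [SigmaFinite μ] (δ : ℝ), largestZero L ≤ δ → δ < 1 →
      ∀ f ∈ bandLimited L,
        ∫⁻ x, ‖f x‖ₑ ^ 2 ∂μ ≤
          ENNReal.ofReal ((2 * Real.pi * ∫ t in δ..1, (legendreP L).eval t ^ 2)⁻¹) *
            eLpNorm f 2 surfaceMeasure ^ 2 * ⨆ y : S2, μ (sphericalCap δ y)) ∧
    (∀ Ω : Set S2, NullMeasurableSet Ω surfaceMeasure →
      concentration 2 (bandLimited L) Ω ≤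
        ENNReal.ofReal (sieveConstant L) * nyquistDensity Ω L) := by
  refine ⟨fun μ _ δ hδ hδ1 f hf => ?_, fun Ω _ => iSup₂_le fun f hf => ?_⟩
  · have hnorm : eLpNorm f 2 surfaceMeasure ^ 2 = ∫⁻ x, ‖f x‖ₑ ^ 2 ∂surfaceMeasure := by
      have := eLpNorm_nnreal_pow_eq_lintegral (f := f) (μ := surfaceMeasure) (p := 2) two_ne_zero
      simpa only [NNReal.coe_ofNat, ENNReal.coe_ofNat, ENNReal.rpow_ofNat] using this
    rw [hnorm]
    exact lintegral_enorm_sq_le_of_mem_bandLimited hL μ hδ hδ1 hf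
  · obtain ⟨h0, h1, -⟩ := legendreP_largestZero hL
    refine ENNReal.div_le_of_le_mul ?_
    simp only [ENNReal.rpow_ofNat]
    -- The second claim is the first for `σ` restricted to `Ω` and the smallest admissible `δ`. All
    -- caps have the same area, so the supremum is that area times the density.
    refine (lintegral_enorm_sq_le_of_mem_bandLimited hL (surfaceMeasure.restrict Ω) le_rfl h1
      hf.1).trans ?_
    have hI := integral_legendreP_sq_pos L h1
    have hcap (y : S2) := surfaceMeasure_sphericalCap (δ := largestZero L) (by linarith) y
    have hpos : 0 < 2 * Real.pi * (1 - largestZero L) := mul_pos Real.two_pi_pos (by linarith)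
    have hsup : ⨆ y : S2, surfaceMeasure.restrict Ω (sphericalCap (largestZero L) y) =
        ENNReal.ofReal (2 * Real.pi * (1 - largestZero L)) * nyquistDensity Ω L := by
      rw [nyquistDensity, ENNReal.mul_iSup]
      refine iSup_congr fun y => ?_
      rw [hcap, Measure.restrict_apply (measurableSet_sphericalCap _ y), Set.inter_comm,
        ENNReal.mul_div_cancel (ENNReal.ofReal_pos.2 hpos).ne' ENNReal.ofReal_ne_top]
    have hconst : ENNReal.ofReal
          ((2 * Real.pi * ∫ t in (largestZero L)..1, (legendreP L).eval t ^ 2)⁻¹) *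
        ENNReal.ofReal (2 * Real.pi * (1 - largestZero L)) = ENNReal.ofReal (sieveConstant L) := by
      rw [← ENNReal.ofReal_mul (by positivity), sieveConstant]
      congr 1
      have := Real.pi_pos
      field_simp
    rw [hsup, ← hconst]
    exact le_of_eq (by ring)
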